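/- Let $(\mathcal X,\Sigma)$ be a measurable space, $\mathcal Y$ a set, $\mathcal H\subseteq\mathcal Y^{\mathcal X}$ nonempty, and $\mu$ a probability measure on $\mathcal X$. For $\sigma>0$ let $B(\mu,\sigma)$ be the set of probability measures $\nu$ on $\mathcal X$ with $\nu(E)\le\mu(E)/\sigma$ for all $E\in\Sigma$. *Complexity.* For $x_{1:n}\in\mathcal X^n$, $n\ge 1$, put $d_{x_{1:n}}(h_1,h_2)=\frac1n\sum_{i=1}^n\mathbf 1\{h_1(x_i)\ne h_2(x_i)\}$, and let $\mathcal N(\varepsilon,\mathcal H,d)\in\mathbb N\cup\{\infty\}$ be the least cardinality of a set $\mathcal H'\subseteq\mathcal H$ such that every $h\in\mathcal H$ has some $h'\in\mathcal H'$ with $d(h,h')\le\varepsilon$. Define $$C_{\varepsilon,\sigma}(\mathcal H,\mu)=\sup_{n\ge1}\ \sup_{\nu_1,\dots,\nu_n\in B(\mu,\sigma)}\ \mathbb E_{x_{1:n}\sim\nu_1\otimes\cdots\otimes\nu_n}\big[\mathcal N(\varepsilon,\mathcal H,d_{x_{1:n}})\big]\in[0,\infty].$$ $\mathcal H$ satisfies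 UBEME with respect to $\mu$ if $C_{\varepsilon,\sigma}(\mathcal H,\mu)<\infty$ for all $\varepsilon,\sigma>0$. *Regret.* A randomized learner $\mathcal A$ maps the past examples $(x_1,y_1),\dots,(x_{t-1},y_{t-1})$ and the current instance $x_t$ to a (discrete) probability distribution on $\mathcal Y$, from which its prediction $\mathcal A(x_t)$ is drawn. Its worst-case expected regret over $T$ rounds is $$R^{\mu,\sigma}_{\mathcal A}(T,\mathcal H)=\sup_{\nu_1,\dots,\nu_T\in B(\mu,\sigma)}\mathbb E_{x_{1:T}\sim\nu_1\otimes\cdots\otimes\nu_T}\Big[\sup_{y_{1:T}\in\mathcal Y^T}\Big(\sum_{t=1}^T\Pr_{\mathcal A}[\mathcal A(x_t)\ne y_t]-\inf_{h\in\mathcal H}\sum_{t=1}^T\mathbf 1\{h(x_t)\ne y_t\}\Big)\Big].$$ If an integrand is not measurable, the expectation in $R$ is read as the upper integral and the expectation in $C$ as the lower integral. *Measurability assumption (modulo $\mu$-null, respectively $\mu^{\otimes n}$-null, sets).* For all $h_1,h_2\in\mathcal H$ the set $\{x:h_1(x)\ne h_2(x)\}$ is measurable, and for every $n$ and $S\subseteq\{1,\dots,n\}$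 the set of $x_{1:n}\in\mathcal X^n$ for which some $h_1,h_2\in\mathcal H$ satisfy $\{i:h_1(x_i)\ne h_2(x_i)\}=S$ is measurable. (The second condition says that all suprema $\sup_{h_1,h_2\in\mathcal H}\sum_{i=1}^n\theta_i\mathbf 1\{h_1(x_i)\ne h_2(x_i)\}$ with signs $\theta_i=\pm1$ are measurable in $x_{1:n}$.) **Theorem.** Under this assumption, for every $\sigma>0$ and every $T\in\mathbb N$, $$\inf_{\mathcal A}R^{\mu,\sigma}_{\mathcal A}(T,\mathcal H)\ \le\ 6\,\inf_{\varepsilon>0}\Big\{\frac{\varepsilon T}{\sigma}+\sqrt{T\log C_{\varepsilon^2,\sigma}(\mathcal H,\mu)}\Big\}.$$ Consequently, if $\mathcal H$ satisfies UBEME with respect to $\mu$, then for every $\sigma>0$ one has $\inf_{\mathcal A}R^{\mu,\sigma}_{\mathcal A}(T,\mathcal H)=o(T)$ as $T\to\infty$, i.e. $\mathcal H$ is smoothed online learnable under $\mu$. (Conventions: $B(\mu,\sigma)=\emptyset$ for $\sigma>1$; the suprema over an empty set are then $0$, and the logarithm's negative part is dropped. For $\sigma\le1$ one has $C\ge1$.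 Also $0\cdot\infty=0$.) -/

import Mathlib

open MeasureTheory Filter Topology
open scoped ENNReal

noncomputable section

namespace SmoothedOnline

variable {X Y : Type*}

/-! ### Covering numbers -/

/-- The covering number of `G` at scale `ε` with respect to `d`: the least cardinality of a subset
`G'` of `G` such that every point of `G` is within `d`-distance `ε` of a point of `G'`
(`⊤` if there is no finite such subset). -/
def coveringNumber {α : Type*} (d : α → α → ℝ) (ε : ℝ) (G : Set α) : ℕ∞ :=
  ⨅ (G' : Set α) (_ : G' ⊆ G ∧ ∀ g ∈ G, ∃ g' ∈ G', d g g' ≤ ε), G'.encard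

open Classical in
/-- The empirical distance on a sample `x₁, …, xₙ`: the fraction of sample points on which two
hypotheses disagree. -/
def empDist {n : ℕ} (x : Fin n → X) (h₁ h₂ : X → Y) : ℝ :=
  (∑ i, if h₁ (x i) ≠ h₂ (x i) then (1 : ℝ) else 0) / n

/-! ### Smooth distributions, expectations, complexity -/

/-- The `σ`-smooth distributions with respect to `μ`: all probability measures `ν` with
`ν E ≤ μ E / σ` for every measurable set `E`. -/
def smooth [MeasurableSpace X] (μ : ProbabilityMeasure X) (σ : ℝ) : Set (ProbabilityMeasure X) :=
  {ν | ∀ E : Set X, MeasurableSet E →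
    (ν : Measure X) E ≤ (μ : Measure X) E / ENNReal.ofReal σ}

/-- The upper integral of a nonnegative function: the infimum of the integrals of its measurable
majorants. For a measurable function it is the usual integral. -/
def upperExpectation {Ω : Type*} [MeasurableSpace Ω] (P : Measure Ω) (f : Ω → ℝ≥0∞) : ℝ≥0∞ :=
  ⨅ (g : Ω → ℝ≥0∞) (_ : Measurable g ∧ ∀ ω, f ω ≤ g ω), ∫⁻ ω, g ω ∂P

/-- The supremum, over sample sizes `n ≥ 1` and sequences `ν₁, …, νₙ` of `σ`-smooth distributions,
of the expected covering number of `H` in the empirical distance of independent `xᵢ ∼ νᵢ`.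
(Should the covering number fail to be measurable in the sample, the expectation is the lower
integral, that is, the supremum of the integrals of measurable minorants.) -/
def complexity [MeasurableSpace X] (ε σ : ℝ) (H : Set (X → Y)) (μ : ProbabilityMeasure X) :
    ℝ≥0∞ :=
  ⨆ (n : ℕ) (_ : 1 ≤ n) (ν : Fin n → ProbabilityMeasure X) (_ : ∀ i, ν i ∈ smooth μ σ),
    ∫⁻ x : Fin n → X, ((coveringNumber (empDist x) ε H : ℕ∞) : ℝ≥0∞)
      ∂(Measure.pi fun i => (ν i : Measure X))

/-- Uniformly bounded expected empirical metric entropy with respect to `μ`. -/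
def UBEME [MeasurableSpace X] (H : Set (X → Y)) (μ : ProbabilityMeasure X) : Prop :=
  ∀ ε σ : ℝ, 0 < ε → 0 < σ → complexity ε σ H μ < ∞

/-! ### Online learners and regret -/

/-- A randomized online learner: from the past labelled examples and the current instance it
produces a probability distribution on labels, from which its prediction is drawn. -/
abbrev Learner (X Y : Type*) := (t : ℕ) → (Fin t → X × Y) → X → PMF Y

/-- The probability that the learner errs in round `t` on the stream `(x₁, y₁), …, (x_T, y_T)`. -/
def expectedLoss (A : Learner X Y) {T : ℕ} (x : Fin T → X) (y : Fin T → Y) (t : Fin T) : ℝ :=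
  ((A t (fun s => (x (s.castLE t.isLt.le), y (s.castLE t.isLt.le))) (x t)).toOuterMeasure
    {z | z ≠ y t}).toReal

open Classical in
/-- The number of mistakes of `h` on the stream. -/
def mistakes (h : X → Y) {T : ℕ} (x : Fin T → X) (y : Fin T → Y) : ℝ :=
  ∑ t, if h (x t) ≠ y t then (1 : ℝ) else 0

/-- The regret of a learner on the instances `x₁, …, x_T`, for the worst choice of labels, which
may depend on all the instances. For nonempty `H` it lies in `[0, T]`. -/
def worstRegret (A : Learner X Y) (H : Set (X → Y)) {T : ℕ} (x : Fin T → X) : ℝ :=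
  ⨆ y : Fin T → Y, ((∑ t, expectedLoss A x y t) - ⨅ h : H, mistakes (h : X → Y) x y)

/-- The worst-case expected regret over `T` rounds of a learner against a smoothed oblivious
adversary: the instances are independent, `xₜ ∼ νₜ`, with each `νₜ` being `σ`-smooth. (Should the
regret fail to be measurable in the instances, the expectation is the upper integral.) -/
def regret [MeasurableSpace X] (A : Learner X Y) (μ : ProbabilityMeasure X) (σ : ℝ) (T : ℕ)
    (H : Set (X → Y)) : ℝ≥0∞ :=
  ⨆ (ν : Fin T → ProbabilityMeasure X) (_ : ∀ t, ν t ∈ smooth μ σ),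
    upperExpectation (Measure.pi fun t => (ν t : Measure X))
      (fun x => ENNReal.ofReal (worstRegret A H x))

/-- The minimax smoothed regret. The learner may depend on `T`, `H`, `μ` and `σ`. -/
def minimaxRegret [MeasurableSpace X] (μ : ProbabilityMeasure X) (σ : ℝ) (T : ℕ)
    (H : Set (X → Y)) : ℝ≥0∞ :=
  ⨅ A : Learner X Y, regret A μ σ T H

/-- Smoothed online learnability of `H` under the base measure `μ`: for every `σ > 0` the minimax
regret is `o(T)`. -/
def LearnableUnder [MeasurableSpace X] (H : Set (X → Y)) (μ : ProbabilityMeasure X) : Prop :=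
  ∀ σ : ℝ, 0 < σ →
    Tendsto (fun T : ℕ => minimaxRegret μ σ T H / (T : ℝ≥0∞)) atTop (𝓝 0)

/-- Measurability of disagreements, up to `μ`-null sets: any two hypotheses disagree on a measurable
set, and for every `n` and every set `S` of indices, the samples on which some two
hypotheses disagree exactly at the indices in `S` form a measurable set. Equivalently, the
functions `x ↦ 1{h₁ x ≠ h₂ x}` are measurable, and so are all the suprema over `h₁, h₂ ∈ H` of
signed sums `∑ i, ± 1{h₁ (x i) ≠ h₂ (x i)}`. -/
structure MeasurableDisagreement [MeasurableSpace X] (H : Set (X → Y))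
    (μ : ProbabilityMeasure X) : Prop where
  pair : ∀ h₁ ∈ H, ∀ h₂ ∈ H, NullMeasurableSet {x | h₁ x ≠ h₂ x} (μ : Measure X)
  pattern : ∀ (n : ℕ) (S : Set (Fin n)),
    NullMeasurableSet {x : Fin n → X | ∃ h₁ ∈ H, ∃ h₂ ∈ H, {i | h₁ (x i) ≠ h₂ (x i)} = S}
      (Measure.pi fun _ : Fin n => (μ : Measure X))

end SmoothedOnline

end

noncomputable section

namespace SmoothedOnline

variable {X Y : Type*}

/-! ### Measure-theoretic preliminaries -/

/-! The learner runs exponential weights on a finite `2ε`-cover of `H` for the disagreement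
probability under `μ`. Such a cover exists with at most `complexity ε σ H μ` elements
(`exists_finset_cover`): for `σ ≤ 1` the measure `μ` is itself smooth, and by Hoeffding a
`2ε`-separated set under `μ` stays separated on long i.i.d. samples, so it bounds the empirical
covering number from below.

Passing from the cover to `H` costs the number of sample points where `h` and its centre `g`
disagree. On an independent ghost sample this number has mean at most `2εT/σ` by smoothness
(`disagreement_le_ghost`). The uniform deviation between sample and ghost is symmetrized
(`lintegral_lintegral_supSum_le`) and bounded by a finite class argument on an empirical cover
(`sum_supSum_le`).

The last bound involves the logarithm of a random covering number. Replacing `log` by a tangent line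
(`sum_supSum_add_le`) makes it linear in that number, so `complexity` applies directly
(`lintegral_ghost_le`), even to a lower integral. Tuning the learning rate then gives the regret
bound. -/

theorem upperExpectation_le_lintegral {Ω : Type*} [MeasurableSpace Ω] {P : Measure Ω}
    {f g : Ω → ℝ≥0∞} (hg : AEMeasurable g P) (hfg : ∀ ω, f ω ≤ g ω) :
    upperExpectation P f ≤ ∫⁻ ω, g ω ∂P := by
  classical
  set N := toMeasurable P {ω | g ω ≠ hg.mk g ω} with hN
  have hN0 : P N = 0 := by
    rw [hN, measure_toMeasurable]
    exact hg.ae_eq_mk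
  have hNm : MeasurableSet N := measurableSet_toMeasurable _ _
  -- The value `⊤` on a measurable null set makes the measurable version of `g` a majorant
  -- everywhere without changing its integral.
  have hmeas : Measurable (N.piecewise (fun _ => (⊤ : ℝ≥0∞)) (hg.mk g)) :=
    Measurable.piecewise hNm measurable_const hg.measurable_mk
  have hle : ∀ ω, f ω ≤ N.piecewise (fun _ => (⊤ : ℝ≥0∞)) (hg.mk g) ω := by
    intro ω
    by_cases h : ω ∈ N
    · simp [h]
    · rw [Set.piecewise_eq_of_notMem _ _ _ h]
      have : g ω = hg.mk g ω := by
        by_contra hne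
        exact h (subset_toMeasurable _ _ hne)
      exact this ▸ hfg ω
  refine (iInf₂_le _ ⟨hmeas, hle⟩).trans (le_of_eq (lintegral_congr_ae ?_))
  have h1 : ∀ᵐ ω ∂P, ω ∉ N := by
    rw [ae_iff]; simpa using hN0
  filter_upwards [h1, hg.ae_eq_mk] with ω hω hω'
  rw [Set.piecewise_eq_of_notMem _ _ _ hω, hω']

/-- Carries the measurability assumption, made only for powers of `μ`, over to products of smooth
measures. Induction splits off coordinate `0`. -/
theorem absolutelyContinuous_pi_fin [MeasurableSpace X] {μ : Measure X} [IsProbabilityMeasure μ] :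
    ∀ {n : ℕ} {ν : Fin n → Measure X} [∀ i, IsProbabilityMeasure (ν i)], (∀ i, ν i ≪ μ) →
      Measure.pi ν ≪ Measure.pi fun _ : Fin n => μ
  | 0, ν, _, _ => by
    have : ν = fun _ => μ := Subsingleton.elim _ _
    rw [this]
  | n + 1, ν, _, h => by
    have h1 := (measurePreserving_piFinSuccAbove ν 0).symm
    have h2 := (measurePreserving_piFinSuccAbove (fun _ : Fin (n + 1) => μ) 0).symm
    rw [← h1.map_eq, ← h2.map_eq]
    exact ((h 0).prod (absolutelyContinuous_pi_fin fun j => h _)).map h1.measurable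

theorem measurePreserving_comp_equiv [MeasurableSpace X] {ι ι' : Type*} [Fintype ι] [Fintype ι']
    (e : ι' ≃ ι) (ν : ι → Measure X) [∀ i, IsProbabilityMeasure (ν i)] :
    MeasurePreserving (fun (x : ι → X) i => x (e i)) (Measure.pi ν)
      (Measure.pi fun i => ν (e i)) :=
  (measurePreserving_piCongrLeft (α := fun _ => X) ν e).symm

/-- Passing to a measurable hull removes the measurability of `E`; disagreement sets are only null
measurable. -/
theorem smooth_apply_le [MeasurableSpace X] {μ ν : ProbabilityMeasure X} {σ : ℝ}
    (hν : ν ∈ smooth μ σ) (E : Set X) :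
    (ν : Measure X) E ≤ (μ : Measure X) E / ENNReal.ofReal σ := by
  refine (measure_mono (subset_toMeasurable (μ : Measure X) E)).trans ?_
  refine (hν _ (measurableSet_toMeasurable _ _)).trans ?_
  rw [measure_toMeasurable]

theorem smooth_absolutelyContinuous [MeasurableSpace X] {μ ν : ProbabilityMeasure X} {σ : ℝ}
    (hν : ν ∈ smooth μ σ) : (ν : Measure X) ≪ μ := by
  intro E hE
  have := smooth_apply_le hν E
  rw [hE, ENNReal.zero_div] at this
  exact le_antisymm this zero_le

theorem self_mem_smooth [MeasurableSpace X] (μ : ProbabilityMeasure X) {σ : ℝ} (hσ : σ ≤ 1) :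
    μ ∈ smooth μ σ := by
  intro E _
  have h : (1 : ℝ≥0∞) ≤ (ENNReal.ofReal σ)⁻¹ :=
    ENNReal.one_le_inv.2 (ENNReal.ofReal_le_one.2 hσ)
  rw [ENNReal.div_eq_inv_mul]
  exact le_mul_of_one_le_left zero_le h

theorem smooth_eq_empty [MeasurableSpace X] (μ : ProbabilityMeasure X) {σ : ℝ} (hσ : 1 < σ) :
    smooth μ σ = ∅ := by
  refine Set.eq_empty_of_forall_notMem fun ν hν => ?_
  have h := hν Set.univ MeasurableSet.univ
  rw [measure_univ, measure_univ, ENNReal.le_div_iff_mul_le (by simp) (by simp), one_mul,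
    ENNReal.ofReal_le_one] at h
  exact absurd h (not_le.2 hσ)

/-! ### Suprema of weighted disagreement sums -/

open Classical in
/-- The supremum over pairs of hypotheses of the total weight of the sample points on which they
disagree. -/
def supSum {ι : Type*} [Fintype ι] (H : Set (X → Y)) (w : ι → ℝ) (x : ι → X) : ℝ≥0∞ :=
  ⨆ (h₁ : H) (h₂ : H),
    ENNReal.ofReal (∑ i, if (h₁ : X → Y) (x i) ≠ (h₂ : X → Y) (x i) then w i else 0)

open Classical in
theorem le_supSum {ι : Type*} [Fintype ι] {H : Set (X → Y)} {h₁ h₂ : X → Y} (h1 : h₁ ∈ H)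
    (h2 : h₂ ∈ H) (w : ι → ℝ) (x : ι → X) :
    ENNReal.ofReal (∑ i, if h₁ (x i) ≠ h₂ (x i) then w i else 0) ≤ supSum H w x :=
  le_iSup₂_of_le (⟨h₁, h1⟩ : H) (⟨h₂, h2⟩ : H) le_rfl

theorem supSum_comp_equiv {ι ι' : Type*} [Fintype ι] [Fintype ι'] (H : Set (X → Y)) (e : ι' ≃ ι)
    (w : ι → ℝ) (x : ι → X) :
    supSum H (fun i => w (e i)) (fun i => x (e i)) = supSum H w x := by
  classical
  unfold supSum
  congr! 5 with h₁ h₂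
  exact e.sum_comp fun i => if (h₁ : X → Y) (x i) ≠ (h₂ : X → Y) (x i) then w i else 0

/-- The weighted sum depends on the pair of hypotheses only through its disagreement pattern `S`.
There are finitely many patterns, so the supremum is a finite supremum of constants on the sets in
`pattern`. -/
theorem aemeasurable_supSum_fin [MeasurableSpace X] {H : Set (X → Y)} {μ : ProbabilityMeasure X}
    (hmeas : MeasurableDisagreement H μ) {n : ℕ} (w : Fin n → ℝ) {ν : Fin n → Measure X}
    [∀ i, IsProbabilityMeasure (ν i)] (hν : ∀ i, ν i ≪ (μ : Measure X)) :
    AEMeasurable (supSum H w) (Measure.pi ν) := by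
  classical
  refine AEMeasurable.mono_ac ?_ (absolutelyContinuous_pi_fin hν)
  have heq : supSum H w = fun x => ⨆ S : Set (Fin n),
      Set.indicator {x : Fin n → X | ∃ h₁ ∈ H, ∃ h₂ ∈ H, {i | h₁ (x i) ≠ h₂ (x i)} = S}
        (fun _ => ENNReal.ofReal (∑ i, if i ∈ S then w i else 0)) x := by
    funext x
    refine le_antisymm (iSup₂_le fun h₁ h₂ => ?_) (iSup_le fun S => ?_)
    · refine le_iSup_of_le {i | (h₁ : X → Y) (x i) ≠ (h₂ : X → Y) (x i)} ?_
      rw [Set.indicator_of_mem (Set.mem_ofPred_eq ▸ ⟨h₁, h₁.2, h₂, h₂.2, rfl⟩)]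
      simp only [Set.mem_ofPred_eq]
      exact le_of_eq (by congr!)
    · refine Set.indicator_apply_le fun hx => ?_
      obtain ⟨h₁, h1, h₂, h2, rfl⟩ := hx
      refine le_trans (le_of_eq ?_) (le_supSum h1 h2 w x)
      simp only [Set.mem_ofPred_eq]
      congr!
  rw [heq]
  exact AEMeasurable.iSup fun S => aemeasurable_const.indicator₀ (hmeas.pattern n S)

/-- General index types are needed for the doubled sample, which is indexed by `ι ⊕ ι`. -/
theorem aemeasurable_supSum [MeasurableSpace X] {H : Set (X → Y)} {μ : ProbabilityMeasure X}
    (hmeas : MeasurableDisagreement H μ) {ι : Type*} [Fintype ι] (w : ι → ℝ) {ν : ι → Measure X}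
    [∀ i, IsProbabilityMeasure (ν i)] (hν : ∀ i, ν i ≪ (μ : Measure X)) :
    AEMeasurable (supSum H w) (Measure.pi ν) := by
  let e := (Fintype.equivFin ι).symm
  have h := (aemeasurable_supSum_fin hmeas (fun i => w (e i)) (ν := fun i => ν (e i))
    fun i => hν _).comp_quasiMeasurePreserving (measurePreserving_comp_equiv e ν).quasiMeasurePreserving
  refine h.congr (ae_of_all _ fun x => ?_)
  exact supSum_comp_equiv H e w x

/-- The expectation of `supSum` does not depend on how the points are paired with
the weights, as long as identically distributed points are exchanged. -/
theorem lintegral_supSum_comp_equiv [MeasurableSpace X] {ι : Type*} [Fintype ι] (H : Set (X → Y))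
    (w : ι → ℝ) (ν : ι → Measure X) [∀ i, IsProbabilityMeasure (ν i)] (e : ι ≃ ι)
    (he : ∀ i, ν (e i) = ν i) :
    ∫⁻ x, supSum H (fun i => w (e i)) x ∂(Measure.pi ν) = ∫⁻ x, supSum H w x ∂(Measure.pi ν) := by
  have h := measurePreserving_comp_equiv e ν
  simp only [he] at h
  have hemb : MeasurableEmbedding (fun (x : ι → X) i => x (e i)) :=
    (MeasurableEquiv.piCongrLeft (fun _ => X) e).symm.measurableEmbedding
  rw [← h.lintegral_comp_emb hemb]
  exact lintegral_congr fun x => supSum_comp_equiv H e w x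

/-! ### Mistakes and losses -/

theorem mistakes_nonneg (h : X → Y) {T : ℕ} (x : Fin T → X) (y : Fin T → Y) :
    0 ≤ mistakes h x y :=
  Finset.sum_nonneg fun _ _ => by split_ifs <;> norm_num

theorem expectedLoss_nonneg (A : Learner X Y) {T : ℕ} (x : Fin T → X) (y : Fin T → Y)
    (t : Fin T) : 0 ≤ expectedLoss A x y t :=
  ENNReal.toReal_nonneg

theorem expectedLoss_le_one (A : Learner X Y) {T : ℕ} (x : Fin T → X) (y : Fin T → Y)
    (t : Fin T) : expectedLoss A x y t ≤ 1 := by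
  refine ENNReal.toReal_le_of_le_ofReal zero_le_one ?_
  rw [ENNReal.ofReal_one]
  exact (measure_mono (Set.subset_univ _)).trans_eq
    ((PMF.toOuterMeasure_apply_eq_one_iff _ _).2 (Set.subset_univ _))

theorem sum_expectedLoss_le (A : Learner X Y) {T : ℕ} (x : Fin T → X) (y : Fin T → Y) :
    ∑ t, expectedLoss A x y t ≤ T := by
  calc ∑ t, expectedLoss A x y t ≤ ∑ _t : Fin T, (1 : ℝ) :=
        Finset.sum_le_sum fun t _ => expectedLoss_le_one A x y t
    _ = T := by simp

open Classical in
theorem mistakes_le_add (h h' : X → Y) {T : ℕ} (x : Fin T → X) (y : Fin T → Y) :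
    mistakes h' x y ≤ mistakes h x y + ∑ t, if h (x t) ≠ h' (x t) then (1 : ℝ) else 0 := by
  unfold mistakes
  rw [← Finset.sum_add_distrib]
  refine Finset.sum_le_sum fun t _ => ?_
  by_cases h1 : h' (x t) = y t
  · simp only [h1, ne_eq, not_true_eq_false, if_false]
    split_ifs <;> norm_num
  · by_cases h2 : h (x t) = y t
    · have : h (x t) ≠ h' (x t) := fun h3 => h1 (h3 ▸ h2)
      simp [h2, h1, Ne.symm h1]
    · simp only [ne_eq, h1, not_false_eq_true, if_true, h2]
      split_ifs <;> norm_num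

/-- A learner whose total loss is at most that of every hypothesis, up to an additive term, has
at most that regret. -/
theorem worstRegret_le [Nonempty Y] {A : Learner X Y} {H : Set (X → Y)} (hH : H.Nonempty) {T : ℕ}
    {x : Fin T → X} {r : ℝ}
    (h : ∀ y, ∀ g ∈ H, ∑ t, expectedLoss A x y t ≤ mistakes g x y + r) :
    worstRegret A H x ≤ r := by
  have := hH.to_subtype
  refine ciSup_le fun y => ?_
  have : ∑ t, expectedLoss A x y t - r ≤ ⨅ g : H, mistakes (g : X → Y) x y :=
    le_ciInf fun g => by linarith [h y g g.2]
  linarith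

/-! ### The exponential weights learner -/

/-- The exponential weight of a hypothesis after the given examples. -/
def expWeight (η : ℝ) {t : ℕ} (p : Fin t → X × Y) (h : X → Y) : ℝ :=
  Real.exp (-η * mistakes h (fun s => (p s).1) fun s => (p s).2)

theorem expWeight_pos (η : ℝ) {t : ℕ} (p : Fin t → X × Y) (h : X → Y) : 0 < expWeight η p h :=
  Real.exp_pos _

theorem sum_expWeight_pos {s : Finset (X → Y)} (hs : s.Nonempty) (η : ℝ) {t : ℕ}
    (p : Fin t → X × Y) : 0 < ∑ h ∈ s, expWeight η p h :=
  Finset.sum_pos (fun _ _ => expWeight_pos _ _ _) hs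

theorem hedge_sum_eq_one {s : Finset (X → Y)} (hs : s.Nonempty) (η : ℝ) {t : ℕ}
    (p : Fin t → X × Y) :
    ∑ h : s, ENNReal.ofReal (expWeight η p h / ∑ g ∈ s, expWeight η p g) = 1 := by
  have hpos := sum_expWeight_pos hs η p
  rw [Finset.sum_coe_sort s fun h =>
      ENNReal.ofReal (expWeight η p h / ∑ g ∈ s, expWeight η p g),
    ← ENNReal.ofReal_sum_of_nonneg fun h _ => (div_pos (expWeight_pos η p h) hpos).le,
    ← Finset.sum_div, div_self hpos.ne', ENNReal.ofReal_one]

/-- The exponential weights (Hedge) learner over a finite set of hypotheses, with learning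
rate `η`. -/
def hedge (s : Finset (X → Y)) (hs : s.Nonempty) (η : ℝ) : Learner X Y := fun _ p x =>
  PMF.map (fun h : s => (h : X → Y) x)
    (PMF.ofFintype (fun h : s => ENNReal.ofReal (expWeight η p h / ∑ g ∈ s, expWeight η p g))
      (hedge_sum_eq_one hs η p))

open Classical in
theorem hedge_loss {s : Finset (X → Y)} (hs : s.Nonempty) (η : ℝ) {t : ℕ} (p : Fin t → X × Y)
    (x : X) (y : Y) :
    ((hedge s hs η t p x).toOuterMeasure {z | z ≠ y}).toReal =
      (∑ h ∈ s, expWeight η p h * if h x ≠ y then 1 else 0) / ∑ g ∈ s, expWeight η p g := by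
  have hpos := sum_expWeight_pos hs η p
  rw [hedge, PMF.toOuterMeasure_map_apply, PMF.toOuterMeasure_apply_fintype,
    ENNReal.toReal_sum, Finset.sum_div, ← Finset.sum_coe_sort s fun h =>
      (expWeight η p h * if h x ≠ y then 1 else 0) / ∑ g ∈ s, expWeight η p g]
  · refine Finset.sum_congr rfl fun h _ => ?_
    by_cases hy : (h : X → Y) x = y
    · simp [hy]
    · rw [Set.indicator_of_mem (by simpa using hy)]
      simp [hy, (div_pos (expWeight_pos η p h) hpos).le]
  · intro h _
    refine ne_top_of_le_ne_top ?_ (Set.indicator_le_self _ _ _)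
    simp

/-- Follows from `exp η ≥ 1 + η + η²/2` and `(1 - η + η²/2)(1 + η + η²/2) = 1 + η⁴/4 ≥ 1`. -/
theorem exp_neg_le_quadratic {η : ℝ} (hη : 0 ≤ η) : Real.exp (-η) ≤ 1 - η + η ^ 2 / 2 := by
  have h := Real.quadratic_le_exp_of_nonneg hη
  rw [Real.exp_neg]
  refine inv_le_of_inv_le₀ (by nlinarith [sq_nonneg (η - 1)]) (le_trans ?_ h)
  rw [inv_le_iff_one_le_mul₀ (by nlinarith [sq_nonneg (η - 1)])]
  nlinarith [sq_nonneg (η ^ 2)]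

/-- Potential argument. For a loss `z ∈ {0, 1}`, `exp (-ηz) = 1 - κz` with `κ = 1 - exp (-η)`, so
each round multiplies the total weight by exactly `1 - κℓ ≤ exp (-κℓ)`, where `ℓ` is the learner's
expected loss. -/
theorem sum_expWeight_le {s : Finset (X → Y)} (hs : s.Nonempty) (η : ℝ) :
    ∀ {T : ℕ} (x : Fin T → X) (y : Fin T → Y),
      ∑ h ∈ s, expWeight η (fun t => (x t, y t)) h ≤
        s.card * Real.exp (-(1 - Real.exp (-η)) * ∑ t, expectedLoss (hedge s hs η) x y t)
  | 0, x, y => by simp [expWeight, mistakes]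
  | T + 1, x, y => by
    classical
    set x' : Fin T → X := fun t => x t.castSucc
    set y' : Fin T → Y := fun t => y t.castSucc
    set p : Fin T → X × Y := fun t => (x' t, y' t)
    set κ := 1 - Real.exp (-η)
    have ih := sum_expWeight_le hs η x' y'
    have hW := sum_expWeight_pos hs η p
    set W := ∑ h ∈ s, expWeight η p h
    set ℓ := expectedLoss (hedge s hs η) x y (Fin.last T)
    have hℓ : ℓ * W = ∑ h ∈ s, expWeight η p h * if h (x (Fin.last T)) ≠ y (Fin.last T) then 1 else 0 := by
      have : ℓ = _ := hedge_loss hs η p (x (Fin.last T)) (y (Fin.last T))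
      rw [this, div_mul_cancel₀ _ hW.ne']
    have hstep : ∑ h ∈ s, expWeight η (fun t => (x t, y t)) h = W * (1 - κ * ℓ) := by
      have : W * (1 - κ * ℓ) = ∑ h ∈ s, (expWeight η p h - κ *
          (expWeight η p h * if h (x (Fin.last T)) ≠ y (Fin.last T) then 1 else 0)) := by
        rw [Finset.sum_sub_distrib, ← Finset.mul_sum, ← hℓ]; ring
      rw [this]
      refine Finset.sum_congr rfl fun h _ => ?_
      have hm : mistakes h x y = mistakes h x' y' +
          if h (x (Fin.last T)) ≠ y (Fin.last T) then 1 else 0 := Fin.sum_univ_castSucc _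
      have hw : expWeight η (fun t => (x t, y t)) h = expWeight η p h *
          Real.exp (-η * if h (x (Fin.last T)) ≠ y (Fin.last T) then 1 else 0) := by
        simp only [expWeight, p]
        rw [hm, mul_add, Real.exp_add]
      rw [hw]
      split_ifs <;> simp only [κ, mul_one, mul_zero, Real.exp_zero, sub_zero]; ring
    have hsum : ∑ t, expectedLoss (hedge s hs η) x y t =
        ∑ t, expectedLoss (hedge s hs η) x' y' t + ℓ := Fin.sum_univ_castSucc _
    rw [hstep, hsum, mul_add, Real.exp_add, ← mul_assoc]
    have h1 : 1 - κ * ℓ ≤ Real.exp (-κ * ℓ) := by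
      have := Real.add_one_le_exp (-κ * ℓ); linarith
    calc W * (1 - κ * ℓ) ≤ W * Real.exp (-κ * ℓ) := by gcongr
      _ ≤ _ := by gcongr

/-- The regret bound of exponential weights. -/
theorem hedge_sum_loss_le {s : Finset (X → Y)} (hs : s.Nonempty) {η : ℝ} (hη : 0 < η) {T : ℕ}
    (x : Fin T → X) (y : Fin T → Y) {h : X → Y} (hh : h ∈ s) :
    ∑ t, expectedLoss (hedge s hs η) x y t ≤
      mistakes h x y + (Real.log s.card / η + η * T / 2) := by
  set Λ := ∑ t, expectedLoss (hedge s hs η) x y t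
  have hΛ : Λ ≤ T := sum_expectedLoss_le _ x y
  have hΛ0 : 0 ≤ Λ := Finset.sum_nonneg fun t _ => expectedLoss_nonneg _ x y t
  have h1 : Real.exp (-η * mistakes h x y) ≤ s.card * Real.exp (-(1 - Real.exp (-η)) * Λ) :=
    (Finset.single_le_sum (f := fun h => expWeight η (fun t => (x t, y t)) h)
      (fun g _ => (expWeight_pos _ _ g).le) hh).trans (sum_expWeight_le hs η x y)
  have hc : (0 : ℝ) < s.card := by exact_mod_cast hs.card_pos
  have h2 := Real.log_le_log (Real.exp_pos _) h1
  rw [Real.log_exp, Real.log_mul hc.ne' (Real.exp_pos _).ne', Real.log_exp] at h2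
  have h3 := exp_neg_le_quadratic hη.le
  have h4 : η * Λ ≤ η * (mistakes h x y + (Real.log s.card / η + η * T / 2)) := by
    have e : η * (mistakes h x y + (Real.log s.card / η + η * T / 2)) =
        η * mistakes h x y + Real.log s.card + η ^ 2 / 2 * T := by
      field_simp
      ring
    rw [e]
    -- The second-order term `η²/2 · Λ` is the price of `κ < η`; bounding `Λ` by `T` makes it the
    -- term `ηT/2` of the regret.
    have h5 : (η - η ^ 2 / 2) * Λ ≤ (1 - Real.exp (-η)) * Λ := 
      mul_le_mul_of_nonneg_right (by linarith) hΛ0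
    have h6 : η ^ 2 / 2 * Λ ≤ η ^ 2 / 2 * T := by gcongr
    nlinarith
  exact le_of_mul_le_mul_left h4 hη

/-! ### Covering and packing -/

/-- By the triangle inequality, two points more than `2ε` apart cannot share a centre within `ε`. -/
theorem card_le_coveringNumber {α : Type*} {d : α → α → ℝ} (hcomm : ∀ a b, d a b = d b a)
    (htri : ∀ a b c, d a c ≤ d a b + d b c) {ε : ℝ} {G : Set α} {s : Finset α} (hs : (s : Set α) ⊆ G)
    (hsep : ∀ a ∈ s, ∀ b ∈ s, a ≠ b → 2 * ε < d a b) :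
    (s.card : ℕ∞) ≤ coveringNumber d ε G := by
  refine le_iInf₂ fun G' hG' => ?_
  choose! f hfG hf using hG'.2
  rw [← Set.encard_coe_eq_coe_finsetCard]
  refine Set.encard_le_encard_of_injOn (f := f) (fun a ha => hfG a (hs ha)) ?_
  intro a ha b hb hab
  by_contra hne
  have h1 := hf a (hs ha)
  have h2 := hf b (hs hb)
  rw [← hab, hcomm] at h2
  linarith [hsep a ha b hb hne, htri a (f a) b]

theorem empDist_comm {n : ℕ} (x : Fin n → X) (h₁ h₂ : X → Y) :
    empDist x h₁ h₂ = empDist x h₂ h₁ := by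
  classical
  unfold empDist
  congr 1
  exact Finset.sum_congr rfl fun i _ => by simp only [ne_comm]

theorem empDist_triangle {n : ℕ} (x : Fin n → X) (h₁ h₂ h₃ : X → Y) :
    empDist x h₁ h₃ ≤ empDist x h₁ h₂ + empDist x h₂ h₃ := by
  classical
  unfold empDist
  rw [← add_div, ← Finset.sum_add_distrib]
  gcongr with i
  by_cases h : h₁ (x i) = h₂ (x i)
  · simp [h]
  · simp only [ne_eq, h, not_false_eq_true, if_true]
    split_ifs <;> norm_num

/-- By Hoeffding's inequality, the empirical distance of two hypotheses is
asymptotically at least their disagreement probability. -/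
theorem tendsto_measure_empDist_le [MeasurableSpace X] {μ : ProbabilityMeasure X} {h₁ h₂ : X → Y}
    (hm : NullMeasurableSet {x | h₁ x ≠ h₂ x} (μ : Measure X)) {a : ℝ}
    (ha : a < (μ : Measure X).real {x | h₁ x ≠ h₂ x}) :
    Tendsto (fun n : ℕ => (Measure.pi fun _ : Fin n => (μ : Measure X)) {x | empDist x h₁ h₂ ≤ a})
      atTop (𝓝 0) := by
  classical
  set A := {x | h₁ x ≠ h₂ x} with hA
  set p := (μ : Measure X).real A with hp
  -- Centred, with values in an interval of length `1`, hence sub-Gaussian with parameter `1/4`. The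
  -- event in question says that these variables sum to at least `n(p - a)`.
  set f : X → ℝ := fun z => p - A.indicator (fun _ => (1 : ℝ)) z with hf
  have hind : AEMeasurable (A.indicator fun _ => (1 : ℝ)) (μ : Measure X) :=
    aemeasurable_const.indicator₀ hm
  have hfm : AEMeasurable f (μ : Measure X) := hind.const_sub p
  have hfb : ∀ z, f z ∈ Set.Icc (p - 1) p := by
    intro z
    by_cases hz : z ∈ A <;> simp [hf, hz]
  have hf0 : ∫ z, f z ∂(μ : Measure X) = 0 := by
    have hi : Integrable (A.indicator fun _ => (1 : ℝ)) (μ : Measure X) :=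
      (integrable_const 1).indicator₀ hm
    rw [hf, integral_sub (integrable_const _) hi, integral_indicator₀ hm]
    simp [hp]
  have hbound : ∀ n : ℕ, (Measure.pi fun _ : Fin n => (μ : Measure X)) {x | empDist x h₁ h₂ ≤ a} ≤
      ENNReal.ofReal (Real.exp (-(2 * (p - a) ^ 2) * n)) := by
    intro n
    rcases Nat.eq_zero_or_pos n with rfl | hn
    · simpa using prob_le_one
    have hn' : (0 : ℝ) < n := by exact_mod_cast hn
    set P := Measure.pi fun _ : Fin n => (μ : Measure X) with hP
    have hindep : ProbabilityTheory.iIndepFun (fun (i : Fin n) (x : Fin n → X) => f (x i)) P :=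
      ProbabilityTheory.iIndepFun_pi fun _ => hfm
    have hsub : ∀ i ∈ (Finset.univ : Finset (Fin n)), ProbabilityTheory.HasSubgaussianMGF
        (fun x : Fin n → X => f (x i)) ((‖p - (p - 1)‖₊ / 2) ^ 2) P := by
      intro i _
      refine ProbabilityTheory.hasSubgaussianMGF_of_mem_Icc_of_integral_eq_zero
        (hfm.comp_quasiMeasurePreserving (Measure.quasiMeasurePreserving_eval _ i))
        (ae_of_all _ fun x => hfb (x i)) ?_
      rw [← hf0]
      exact integral_comp_eval (μ := fun _ : Fin n => (μ : Measure X)) (i := i)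
        hfm.aestronglyMeasurable
    have hδ : 0 ≤ n * (p - a) := mul_nonneg hn'.le (sub_nonneg.2 ha.le)
    have hH := ProbabilityTheory.HasSubgaussianMGF.measure_sum_ge_le_of_iIndepFun hindep hsub hδ
    rw [← ofReal_measureReal]
    refine ENNReal.ofReal_le_ofReal (le_trans (measureReal_mono ?_) (hH.trans_eq ?_))
    · intro x hx
      have hx' : (∑ i, if h₁ (x i) ≠ h₂ (x i) then (1 : ℝ) else 0) ≤ a * n := by
        have : empDist x h₁ h₂ ≤ a := hx
        rwa [empDist, div_le_iff₀ hn'] at this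
      have : ∑ i, f (x i) = n * p - ∑ i, if h₁ (x i) ≠ h₂ (x i) then (1 : ℝ) else 0 := by
        simp [hf, Finset.sum_sub_distrib, Set.indicator_apply, hA]
      simp only [Set.mem_ofPred_eq, this]
      linarith
    · congr 1
      simp
      field_simp
  refine tendsto_of_tendsto_of_tendsto_of_le_of_le tendsto_const_nhds ?_ (fun _ => zero_le) hbound
  rw [← ENNReal.ofReal_zero]
  refine ENNReal.tendsto_ofReal (Real.tendsto_exp_atBot.comp ?_)
  have : 0 < 2 * (p - a) ^ 2 := by have := sub_pos.2 ha; positivity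
  exact (tendsto_natCast_atTop_atTop).const_mul_atTop_of_neg (neg_lt_zero.2 this)

theorem lintegral_coveringNumber_le_complexity [MeasurableSpace X] {μ : ProbabilityMeasure X}
    {ε σ : ℝ} {H : Set (X → Y)} {n : ℕ} (hn : 1 ≤ n) {ν : Fin n → ProbabilityMeasure X}
    (hν : ∀ i, ν i ∈ smooth μ σ) :
    ∫⁻ x : Fin n → X, ((coveringNumber (empDist x) ε H : ℕ∞) : ℝ≥0∞)
      ∂(Measure.pi fun i => (ν i : Measure X)) ≤ complexity ε σ H μ :=
  le_iSup₂_of_le n hn (le_iSup₂_of_le ν hν le_rfl)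

/-- A separated set of hypotheses has at most `complexity` many elements. -/
theorem card_le_complexity [MeasurableSpace X] {μ : ProbabilityMeasure X} {H : Set (X → Y)}
    (hpair : ∀ h₁ ∈ H, ∀ h₂ ∈ H, NullMeasurableSet {x | h₁ x ≠ h₂ x} (μ : Measure X))
    {ε σ : ℝ} (hσ : σ ≤ 1) {s : Finset (X → Y)} (hs : (s : Set (X → Y)) ⊆ H)
    (hsep : ∀ h₁ ∈ s, ∀ h₂ ∈ s, h₁ ≠ h₂ → 2 * ε < (μ : Measure X).real {x | h₁ x ≠ h₂ x}) :
    (s.card : ℝ≥0∞) ≤ complexity ε σ H μ := by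
  classical
  let P (n : ℕ) := Measure.pi fun _ : Fin n => (μ : Measure X)
  -- Off this event `s` is `2ε`-separated empirically. It is a finite union of events of vanishing
  -- probability.
  let bad (n : ℕ) : Set (Fin n → X) := ⋃ q ∈ s.offDiag, {x | empDist x q.1 q.2 ≤ 2 * ε}
  have hbad : Tendsto (fun n => P n (bad n)) atTop (𝓝 0) := by
    have h1 : Tendsto (fun n => ∑ q ∈ s.offDiag, P n {x | empDist x q.1 q.2 ≤ 2 * ε}) atTop
        (𝓝 (∑ q ∈ s.offDiag, 0)) := by
      refine tendsto_finsetSum _ fun q hq => ?_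
      obtain ⟨h1, h2, h3⟩ := Finset.mem_offDiag.1 hq
      exact tendsto_measure_empDist_le (hpair _ (hs h1) _ (hs h2)) (hsep _ h1 _ h2 h3)
    rw [Finset.sum_const_zero] at h1
    exact tendsto_of_tendsto_of_tendsto_of_le_of_le tendsto_const_nhds h1 (fun _ => zero_le)
      fun n => measure_biUnion_finset_le _ _
  have hle : ∀ n ≥ 1, (s.card : ℝ≥0∞) * (1 - P n (bad n)) ≤ complexity ε σ H μ := by
    intro n hn
    refine le_trans ?_ (lintegral_coveringNumber_le_complexity hn fun _ => self_mem_smooth μ hσ)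
    -- With a measurable hull in place of `bad n`, the indicator of the complement is measurable and
    -- its integral can be computed.
    set B := toMeasurable (P n) (bad n)
    have hB : MeasurableSet B := measurableSet_toMeasurable _ _
    have h1 : 1 - P n (bad n) = P n Bᶜ := by
      rw [prob_compl_eq_one_sub hB, measure_toMeasurable]
    rw [h1, ← lintegral_indicator_const hB.compl]
    refine lintegral_mono fun x => Set.indicator_apply_le' (fun hx => ?_) fun _ => zero_le
    have h2 : (s.card : ℕ∞) ≤ coveringNumber (empDist x) ε H := by
      refine card_le_coveringNumber (empDist_comm x) (empDist_triangle x) hs fun a ha b hb hab => ?_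
      by_contra hlt
      refine hx (subset_toMeasurable _ _ ?_)
      simp only [bad, Set.mem_iUnion]
      exact ⟨(a, b), Finset.mem_offDiag.2 ⟨ha, hb, hab⟩, not_lt.1 hlt⟩
    simpa using ENat.toENNReal_le.2 h2
  have hlim : Tendsto (fun n => (s.card : ℝ≥0∞) * (1 - P n (bad n))) atTop
      (𝓝 ((s.card : ℝ≥0∞) * (1 - 0))) :=
    ENNReal.Tendsto.const_mul (ENNReal.Tendsto.sub tendsto_const_nhds hbad (Or.inl (by simp)))
      (Or.inr (by simp))
  rw [tsub_zero, mul_one] at hlim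
  exact le_of_tendsto hlim (eventually_atTop.2 ⟨1, hle⟩)

/-- A class of finite complexity has a finite cover with respect to the disagreement
probability. -/
theorem exists_finset_cover [MeasurableSpace X] {μ : ProbabilityMeasure X} {H : Set (X → Y)}
    (hpair : ∀ h₁ ∈ H, ∀ h₂ ∈ H, NullMeasurableSet {x | h₁ x ≠ h₂ x} (μ : Measure X))
    {ε σ : ℝ} (hε : 0 < ε) (hσ : σ ≤ 1) (hC : complexity ε σ H μ ≠ ∞) :
    ∃ s : Finset (X → Y), (s : Set (X → Y)) ⊆ H ∧ (s.card : ℝ≥0∞) ≤ complexity ε σ H μ ∧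
      ∀ h ∈ H, ∃ g ∈ s, (μ : Measure X).real {x | h x ≠ g x} ≤ 2 * ε := by
  classical
  let sep (s : Finset (X → Y)) : Prop := (s : Set (X → Y)) ⊆ H ∧
    ∀ h₁ ∈ s, ∀ h₂ ∈ s, h₁ ≠ h₂ → 2 * ε < (μ : Measure X).real {x | h₁ x ≠ h₂ x}
  have hbound : ∀ s, sep s → s.card ≤ ⌊(complexity ε σ H μ).toReal⌋₊ := by
    intro s hs
    refine Nat.le_floor ?_
    rw [← ENNReal.toReal_natCast]
    exact ENNReal.toReal_mono hC (card_le_complexity hpair hσ hs.1 hs.2)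
  -- A separated set of maximal size is a cover: an uncovered hypothesis could be added to it.
  obtain ⟨s, hs, hmax⟩ : ∃ s, sep s ∧ ∀ s', sep s' → s'.card ≤ s.card := by
    obtain ⟨s, hs, hcard⟩ := Nat.findGreatest_spec (P := fun m => ∃ s, sep s ∧ s.card = m)
      (Nat.zero_le ⌊(complexity ε σ H μ).toReal⌋₊) ⟨∅, by simp [sep], rfl⟩
    refine ⟨s, hs, fun s' hs' => ?_⟩
    rw [hcard]
    exact Nat.le_findGreatest (hbound s' hs') ⟨s', hs', rfl⟩
  refine ⟨s, hs.1, card_le_complexity hpair hσ hs.1 hs.2, fun h hh => ?_⟩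
  by_contra! hcon
  have hns : h ∉ s := fun hmem => by
    have := hcon h hmem
    simp at this
    linarith
  have hsep : sep (insert h s) := by
    refine ⟨by simpa [Set.insert_subset_iff] using ⟨hh, hs.1⟩, fun a ha b hb hab => ?_⟩
    rcases Finset.mem_insert.1 ha with rfl | ha' <;> rcases Finset.mem_insert.1 hb with rfl | hb'
    · exact absurd rfl hab
    · exact hcon b hb'
    · simpa only [ne_comm] using hcon a ha'
    · exact hs.2 a ha' b hb' hab
  have := hmax _ hsep
  rw [Finset.card_insert_of_notMem hns] at this
  omega

/-! ### Rademacher sums -/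

/-- The sign encoded by a Boolean. -/
def sgn (b : Bool) : ℝ := if b then 1 else -1

/-- The sum over sign vectors factorizes into the product of `2 cosh (a t)`, and `cosh u ≤ exp
(u²/2)`. -/
theorem sum_exp_sgn_le {ι : Type*} [Fintype ι] [DecidableEq ι] (a : ι → ℝ) :
    ∑ b : ι → Bool, Real.exp (∑ t, sgn (b t) * a t) ≤
      2 ^ Fintype.card ι * Real.exp (∑ t, a t ^ 2 / 2) := by
  have h1 : ∑ b : ι → Bool, Real.exp (∑ t, sgn (b t) * a t) =
      ∏ t, ∑ c : Bool, Real.exp (sgn c * a t) := by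
    rw [Finset.prod_univ_sum, Fintype.piFinset_univ]
    exact Finset.sum_congr rfl fun b _ => Real.exp_sum _ _
  have h2 : ∀ t, ∑ c : Bool, Real.exp (sgn c * a t) = 2 * Real.cosh (a t) := by
    intro t
    simp [sgn, Real.cosh_eq]
    ring
  rw [h1, Real.exp_sum]
  simp only [h2, Finset.prod_mul_distrib, Finset.prod_const, Finset.card_univ]
  refine mul_le_mul_of_nonneg_left ?_ (by positivity)
  exact Finset.prod_le_prod (fun t _ => (Real.cosh_pos _).le)
    fun t _ => Real.cosh_le_exp_half_sq _

theorem exists_finset_of_coveringNumber {α : Type*} {d : α → α → ℝ} {ε : ℝ} {G : Set α} {m : ℕ}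
    (h : coveringNumber d ε G = m) :
    ∃ s : Finset α, (s : Set α) ⊆ G ∧ s.card ≤ m ∧ ∀ g ∈ G, ∃ g' ∈ s, d g g' ≤ ε := by
  have hlt : coveringNumber d ε G < m + 1 := by
    rw [h]; exact_mod_cast Nat.lt_succ_self m
  obtain ⟨G', hG''⟩ := iInf_lt_iff.1 hlt
  obtain ⟨hG', hcard⟩ := iInf_lt_iff.1 hG''
  have hfin : G'.Finite := Set.encard_lt_top_iff.1 (hcard.trans_le le_top)
  refine ⟨hfin.toFinset, by simpa using hG'.1, ?_, by simpa using hG'.2⟩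
  rw [hfin.encard_eq_coe_toFinset_card] at hcard
  have : hfin.toFinset.card < m + 1 := by exact_mod_cast hcard
  omega

/-- A finite class bound for Rademacher sums: if the hypotheses can be covered by `m` of them, then
the Rademacher average of their disagreement sums is controlled. -/
theorem sum_supSum_le {H : Set (X → Y)} (hH : H.Nonempty) {n m : ℕ} (hn : 1 ≤ n) {x : Fin n → X}
    {ε : ℝ} (hN : coveringNumber (empDist x) ε H = m) {l : ℝ} (hl : 0 < l) :
    1 ≤ m ∧ ∑ b : Fin n → Bool, supSum H (fun t => sgn (b t)) x ≤
      ENNReal.ofReal (2 ^ n * ((2 * Real.log m + 2 * ε * l * n + l ^ 2 * n / 2) / l)) := by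
  classical
  obtain ⟨s, hsH, hsm, hcov⟩ := exists_finset_of_coveringNumber hN
  have hn' : (0 : ℝ) < n := by exact_mod_cast hn
  have hm : 1 ≤ m := by
    obtain ⟨h, hh⟩ := hH
    obtain ⟨g, hg, -⟩ := hcov h hh
    exact (Finset.card_pos.2 ⟨g, hg⟩).trans_le hsm
  refine ⟨hm, ?_⟩
  have hm' : (0 : ℝ) < m := by exact_mod_cast hm
  let v (b : Fin n → Bool) (h₁ h₂ : X → Y) : ℝ := ∑ t, if h₁ (x t) ≠ h₂ (x t) then sgn (b t) else 0
  -- Dominates `exp (l * v b h₁ h₂)` for all pairs in `H` at once: replacing both hypotheses by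
  -- centres changes `v` by at most `2εn`. `B` below bounds the average of `E` over the signs.
  let E (b : Fin n → Bool) : ℝ := ∑ g₁ ∈ s, ∑ g₂ ∈ s, Real.exp (2 * ε * l * n) * Real.exp (l * v b g₁ g₂)
  set B : ℝ := m ^ 2 * (Real.exp (2 * ε * l * n) * Real.exp (l ^ 2 * n / 2)) with hB
  have hBpos : 0 < B := by positivity
  have hlogB : Real.log B = 2 * Real.log m + 2 * ε * l * n + l ^ 2 * n / 2 := by
    rw [hB, Real.log_mul (by positivity) (by positivity),
      Real.log_mul (by positivity) (by positivity), Real.log_exp, Real.log_exp, Real.log_pow]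
    push_cast; ring
  have hsumE : ∑ b, E b ≤ 2 ^ n * B := by
    have h1 : ∀ g₁ g₂ : X → Y, ∑ b, Real.exp (l * v b g₁ g₂) ≤ 2 ^ n * Real.exp (l ^ 2 * n / 2) := by
      intro g₁ g₂
      have h2 := sum_exp_sgn_le fun t : Fin n => if g₁ (x t) ≠ g₂ (x t) then l else 0
      have h3 : ∀ b, l * v b g₁ g₂ = ∑ t, sgn (b t) * if g₁ (x t) ≠ g₂ (x t) then l else 0 := by
        intro b
        simp only [v, Finset.mul_sum]
        refine Finset.sum_congr rfl fun t _ => ?_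
        split_ifs <;> ring
      simp only [h3]
      refine h2.trans ?_
      rw [Fintype.card_fin]
      gcongr
      calc ∑ t : Fin n, (if g₁ (x t) ≠ g₂ (x t) then l else 0) ^ 2 / 2
          ≤ ∑ t : Fin n, l ^ 2 / 2 := by
            refine Finset.sum_le_sum fun t _ => ?_
            split_ifs
            · exact le_rfl
            · simpa using by positivity
        _ = l ^ 2 * n / 2 := by simp; ring
    calc ∑ b, E b = ∑ g₁ ∈ s, ∑ g₂ ∈ s, Real.exp (2 * ε * l * n) * ∑ b, Real.exp (l * v b g₁ g₂) := by
          simp only [E]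
          rw [Finset.sum_comm]
          refine Finset.sum_congr rfl fun g₁ _ => ?_
          rw [Finset.sum_comm]
          exact Finset.sum_congr rfl fun g₂ _ => (Finset.mul_sum _ _ _).symm
      _ ≤ ∑ g₁ ∈ s, ∑ g₂ ∈ s, Real.exp (2 * ε * l * n) * (2 ^ n * Real.exp (l ^ 2 * n / 2)) := by
          gcongr; exact h1 _ _
      _ = (s.card : ℝ) ^ 2 * (Real.exp (2 * ε * l * n) * (2 ^ n * Real.exp (l ^ 2 * n / 2))) := by
          simp only [Finset.sum_const, nsmul_eq_mul]; ring
      _ ≤ (m : ℝ) ^ 2 * (Real.exp (2 * ε * l * n) * (2 ^ n * Real.exp (l ^ 2 * n / 2))) := by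
          gcongr
      _ = 2 ^ n * B := by rw [hB]; ring
  have hv : ∀ b, ∀ h₁ ∈ H, ∀ h₂ ∈ H, Real.exp (l * v b h₁ h₂) ≤ E b := by
    intro b h₁ hh₁ h₂ hh₂
    obtain ⟨g₁, hg₁, hd₁⟩ := hcov h₁ hh₁
    obtain ⟨g₂, hg₂, hd₂⟩ := hcov h₂ hh₂
    rw [empDist, div_le_iff₀ hn'] at hd₁ hd₂
    have h1 : v b h₁ h₂ ≤ v b g₁ g₂ + 2 * ε * n := by
      have : v b h₁ h₂ ≤ v b g₁ g₂ + (∑ t, if h₁ (x t) ≠ g₁ (x t) then (1 : ℝ) else 0) +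
          ∑ t, if h₂ (x t) ≠ g₂ (x t) then (1 : ℝ) else 0 := by
        simp only [v, ← Finset.sum_add_distrib]
        refine Finset.sum_le_sum fun t _ => ?_
        have hs : sgn (b t) = 1 ∨ sgn (b t) = -1 := by cases b t <;> simp [sgn]
        by_cases e₁ : h₁ (x t) = g₁ (x t) <;> by_cases e₂ : h₂ (x t) = g₂ (x t) <;>
          rcases hs with hs | hs <;> simp only [hs, e₁, e₂, ne_eq, not_true_eq_false, if_false,
            not_false_eq_true, if_true] <;> split_ifs <;> norm_num
      linarith
    calc Real.exp (l * v b h₁ h₂) ≤ Real.exp (l * (v b g₁ g₂ + 2 * ε * n)) := by gcongr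
      _ = Real.exp (2 * ε * l * n) * Real.exp (l * v b g₁ g₂) := by
          rw [← Real.exp_add]; congr 1; ring
      _ ≤ ∑ g₂ ∈ s, Real.exp (2 * ε * l * n) * Real.exp (l * v b g₁ g₂) :=
          Finset.single_le_sum (f := fun g₂ => Real.exp (2 * ε * l * n) * Real.exp (l * v b g₁ g₂))
            (fun _ _ => by positivity) hg₂
      _ ≤ E b :=
          Finset.single_le_sum (f := fun g₁ => ∑ g₂ ∈ s, Real.exp (2 * ε * l * n) *
            Real.exp (l * v b g₁ g₂)) (fun _ _ => by positivity) hg₁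
  have hw : ∀ b, ∀ h₁ ∈ H, ∀ h₂ ∈ H, v b h₁ h₂ ≤ (Real.log B - 1 + E b / B) / l := by
    intro b h₁ hh₁ h₂ hh₂
    -- The tangent to `log` at `B` takes the place of Jensen's inequality: averaged over `b`, the
    -- right side of `hw` is at most `log B / l`.
    have h1 := Real.log_le_sub_one_of_pos (div_pos (Real.exp_pos (l * v b h₁ h₂)) hBpos)
    rw [Real.log_div (Real.exp_pos _).ne' hBpos.ne', Real.log_exp] at h1
    have h2 : Real.exp (l * v b h₁ h₂) / B ≤ E b / B := by
      gcongr; exact hv b h₁ hh₁ h₂ hh₂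
    rw [le_div_iff₀ hl]
    linarith
  have hnonneg : ∀ b, 0 ≤ (Real.log B - 1 + E b / B) / l := by
    intro b
    obtain ⟨h, hh⟩ := hH
    simpa [v] using hw b h hh h hh
  calc ∑ b : Fin n → Bool, supSum H (fun t => sgn (b t)) x
      ≤ ∑ b, ENNReal.ofReal ((Real.log B - 1 + E b / B) / l) :=
        Finset.sum_le_sum fun b _ => iSup₂_le fun h₁ h₂ =>
          ENNReal.ofReal_le_ofReal (hw b h₁ h₁.2 h₂ h₂.2)
    _ = ENNReal.ofReal (∑ b, (Real.log B - 1 + E b / B) / l) :=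
        (ENNReal.ofReal_sum_of_nonneg fun b _ => hnonneg b).symm
    _ ≤ _ := by
        refine ENNReal.ofReal_le_ofReal ?_
        rw [← hlogB, ← Finset.sum_div, ← mul_div_assoc, Finset.sum_add_distrib, ← Finset.sum_div]
        have h1 : (∑ b, E b) / B ≤ 2 ^ n := by rwa [div_le_iff₀ hBpos]
        gcongr
        simp only [Finset.sum_const, Finset.card_univ, Fintype.card_pi, Fintype.card_bool,
          Finset.prod_const, Fintype.card_fin, nsmul_eq_mul, Nat.cast_pow, Nat.cast_ofNat]
        linarith

/-- The expected Rademacher average is bounded in terms of the expected covering number. -/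
theorem sum_supSum_add_le {H : Set (X → Y)} (hH : H.Nonempty) {n : ℕ} (hn : 1 ≤ n) (x : Fin n → X)
    {ε : ℝ} (hε : 0 ≤ ε) {l c : ℝ} (hl : 0 < l) (hc : 1 ≤ c) :
    ∑ b : Fin n → Bool, supSum H (fun t => sgn (b t)) x + 2 ^ n * ENNReal.ofReal (2 / l) ≤
      2 ^ n * (ENNReal.ofReal (2 / l * Real.log c + 2 * ε * n + l * n / 2) +
        ENNReal.ofReal (2 / (l * c)) * (coveringNumber (empDist x) ε H : ℕ∞)) := by
  have hc0 : 0 < c := by linarith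
  induction hN : coveringNumber (empDist x) ε H using ENat.recTopCoe with
  | top =>
    have : ENNReal.ofReal (2 / (l * c)) ≠ 0 := by
      rw [ENNReal.ofReal_ne_zero_iff]; positivity
    rw [ENat.toENNReal_top, ENNReal.mul_top this, add_top, ENNReal.mul_top (by simp)]
    exact le_top
  | coe m =>
    obtain ⟨hm, h⟩ := sum_supSum_le hH hn hN hl
    have hm' : (0 : ℝ) < m := by exact_mod_cast hm
    have hlogc : 0 ≤ Real.log c := Real.log_nonneg hc
    have hlogm : 0 ≤ Real.log m := Real.log_nonneg (by exact_mod_cast hm)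
    have h2 : (2 : ℝ≥0∞) ^ n = ENNReal.ofReal (2 ^ n) := by
      rw [ENNReal.ofReal_pow (by norm_num), ENNReal.ofReal_ofNat]
    have h3 : ((m : ℕ∞) : ℝ≥0∞) = ENNReal.ofReal m := by simp
    rw [h2, h3]
    refine (add_le_add_left h _).trans ?_
    rw [← ENNReal.ofReal_mul (by positivity), ← ENNReal.ofReal_mul (by positivity),
      ← ENNReal.ofReal_add (by positivity) (by positivity),
      ← ENNReal.ofReal_add (by positivity) (by positivity), ← ENNReal.ofReal_mul (by positivity),
      ← mul_add]
    refine ENNReal.ofReal_le_ofReal ?_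
    -- Tangent to `log` at `c`: `log m ≤ log c + m/c - 1`. The `-1` accounts for the extra `2/l` on
    -- the left of the claim.
    have h1 := Real.log_le_sub_one_of_pos (div_pos hm' hc0)
    rw [Real.log_div hm'.ne' hc0.ne'] at h1
    refine mul_le_mul_of_nonneg_left ?_ (by positivity)
    have e1 : (2 * Real.log m + 2 * ε * l * n + l ^ 2 * n / 2) / l + 2 / l =
        2 / l * (Real.log m + 1) + 2 * ε * n + l * n / 2 := by field_simp; ring
    have e2 : 2 / (l * c) * m = 2 / l * (m / c) := by field_simp
    rw [e1, e2]
    have : 2 / l * (Real.log m + 1) ≤ 2 / l * (Real.log c + m / c) :=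
      mul_le_mul_of_nonneg_left (by linarith) (by positivity)
    linarith

/-! ### Symmetrization -/

section Symmetrization

variable {ι : Type*}

/-- The involution of `ι ⊕ ι` exchanging the two copies of the indices on which `b` is false. -/
def swapWhere (b : ι → Bool) : Equiv.Perm (ι ⊕ ι) :=
  Function.Involutive.toPerm
    (Sum.elim (fun t => if b t then Sum.inl t else Sum.inr t)
      fun t => if b t then Sum.inr t else Sum.inl t) (by
    rintro (t | t) <;> by_cases h : b t <;> simp [h])

theorem swapWhere_inl (b : ι → Bool) (t : ι) :
    swapWhere b (Sum.inl t) = if b t then Sum.inl t else Sum.inr t := rfl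

theorem swapWhere_inr (b : ι → Bool) (t : ι) :
    swapWhere b (Sum.inr t) = if b t then Sum.inr t else Sum.inl t := rfl

theorem sumElim_comp_swapWhere (b : ι → Bool) (i : ι ⊕ ι) :
    Sum.elim (fun _ : ι => (1 : ℝ)) (fun _ => -1) (swapWhere b i) =
      Sum.elim (fun t => sgn (b t)) (fun t => sgn (!b t)) i := by
  rcases i with t | t <;> by_cases h : b t <;> simp [h, swapWhere_inl, swapWhere_inr, sgn]

variable [Fintype ι]

/-- Decouples the two halves of the doubled sample: a supremum of sums is at most the sum of the
suprema. -/
theorem supSum_sumElim_le (H : Set (X → Y)) (a b : ι → ℝ) (x x' : ι → X) :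
    supSum H (Sum.elim a b) (Sum.elim x x') ≤ supSum H a x + supSum H b x' := by
  classical
  refine iSup₂_le fun h₁ h₂ => ?_
  rw [Fintype.sum_sum_type]
  refine ENNReal.ofReal_add_le.trans (add_le_add ?_ ?_)
  · exact le_supSum h₁.2 h₂.2 a x
  · exact le_supSum h₁.2 h₂.2 b x'

variable [MeasurableSpace X] {μ : ProbabilityMeasure X} {H : Set (X → Y)}
  {ν : ι → Measure X} [∀ i, IsProbabilityMeasure (ν i)]

theorem measurePreserving_sumElim :
    MeasurePreserving (fun z : (ι → X) × (ι → X) => (Sum.elim z.1 z.2 : ι ⊕ ι → X))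
      ((Measure.pi ν).prod (Measure.pi ν)) (Measure.pi fun i => ν (Sum.elim id id i)) := by
  have h : MeasurePreserving _ ((Measure.pi ν).prod (Measure.pi ν)) _ :=
    measurePreserving_sumPiEquivProdPi_symm (X := fun _ : ι ⊕ ι => X)
      (fun i => ν (Sum.elim id id i))
  convert h using 1
  funext z i
  rcases i with t | t <;> rfl

theorem aemeasurable_supSum_sumElim (hmeas : MeasurableDisagreement H μ)
    (hν : ∀ i, ν i ≪ (μ : Measure X)) (w : ι ⊕ ι → ℝ) :
    AEMeasurable (fun z : (ι → X) × (ι → X) => supSum H w (Sum.elim z.1 z.2))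
      ((Measure.pi ν).prod (Measure.pi ν)) :=
  (aemeasurable_supSum hmeas w fun _ => hν _).comp_quasiMeasurePreserving
    measurePreserving_sumElim.quasiMeasurePreserving

/-- Views sample and ghost as one sample over `ι ⊕ ι`, on which `swapWhere` acts. -/
theorem lintegral_lintegral_supSum (hmeas : MeasurableDisagreement H μ)
    (hν : ∀ i, ν i ≪ (μ : Measure X)) (w : ι ⊕ ι → ℝ) :
    ∫⁻ x, ∫⁻ x', supSum H w (Sum.elim x x') ∂(Measure.pi ν) ∂(Measure.pi ν) =
      ∫⁻ z, supSum H w z ∂(Measure.pi fun i => ν (Sum.elim id id i)) := by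
  have h := measurePreserving_sumElim (ν := ν)
  rw [← lintegral_prod _ (aemeasurable_supSum_sumElim hmeas hν w), ← h.map_eq,
    lintegral_map' _ h.measurable.aemeasurable]
  rw [h.map_eq]
  exact aemeasurable_supSum hmeas w fun _ => hν _

/-- Symmetrization for a fixed choice of signs. -/
theorem lintegral_lintegral_supSum_le (hmeas : MeasurableDisagreement H μ)
    (hν : ∀ i, ν i ≪ (μ : Measure X)) (b : ι → Bool) :
    ∫⁻ x, ∫⁻ x', supSum H (Sum.elim (fun _ => 1) fun _ => -1) (Sum.elim x x')
        ∂(Measure.pi ν) ∂(Measure.pi ν) ≤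
      ∫⁻ x, supSum H (fun t => sgn (b t)) x ∂(Measure.pi ν) +
        ∫⁻ x, supSum H (fun t => sgn (!b t)) x ∂(Measure.pi ν) := by
  -- Only the `t`-th points of the two samples are exchanged. Both have law `ν t`, so the `ν t` may
  -- differ from one another.
  rw [lintegral_lintegral_supSum hmeas hν, ← lintegral_supSum_comp_equiv H _
    (fun i => ν (Sum.elim id id i)) (swapWhere b)]
  · simp only [sumElim_comp_swapWhere]
    rw [← lintegral_lintegral_supSum hmeas hν]
    calc _ ≤ ∫⁻ x, ∫⁻ x', (supSum H (fun t => sgn (b t)) x + supSum H (fun t => sgn (!b t)) x')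
          ∂(Measure.pi ν) ∂(Measure.pi ν) :=
          lintegral_mono fun x => lintegral_mono fun x' => supSum_sumElim_le H _ _ x x'
      _ = _ := by
          simp only [lintegral_add_left measurable_const, lintegral_const, measure_univ, mul_one]
          rw [lintegral_add_right _ measurable_const, lintegral_const, measure_univ, mul_one]
  · rintro (t | t) <;> by_cases h : b t <;> simp [h, swapWhere_inl, swapWhere_inr]

open Classical in
/-- Introduction of a ghost sample. -/
theorem disagreement_le_ghost (hmeas : MeasurableDisagreement H μ)
    (hν : ∀ i, ν i ≪ (μ : Measure X)) {h g : X → Y} (hh : h ∈ H) (hg : g ∈ H) (x : ι → X) :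
    ENNReal.ofReal (∑ t, if h (x t) ≠ g (x t) then 1 else 0) ≤
      ∑ t, ν t {z | h z ≠ g z} +
        ∫⁻ x', supSum H (Sum.elim (fun _ => 1) fun _ => -1) (Sum.elim x x') ∂(Measure.pi ν) := by
  set A := {z | h z ≠ g z} with hA
  have hAm : ∀ t, NullMeasurableSet A (ν t) := fun t => (hmeas.pair h hh g hg).mono_ac (hν t)
  have hpre : ∀ t, NullMeasurableSet ((fun x : ι → X => x t) ⁻¹' A) (Measure.pi ν) := fun t =>
    (hAm t).preimage (Measure.quasiMeasurePreserving_eval ν t)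
  have hind : ∀ t, AEMeasurable (((fun x : ι → X => x t) ⁻¹' A).indicator
      (1 : (ι → X) → ℝ≥0∞)) (Measure.pi ν) := fun t => aemeasurable_one.indicator₀ (hpre t)
  have hG : ∫⁻ x' : ι → X, ∑ t, ((fun x : ι → X => x t) ⁻¹' A).indicator 1 x' ∂(Measure.pi ν) =
      ∑ t, ν t A := by
    rw [lintegral_finsetSum' _ fun t _ => hind t]
    refine Finset.sum_congr rfl fun t _ => ?_
    rw [lintegral_indicator_one₀ (hpre t)]
    exact (measurePreserving_eval ν t).measure_preimage (hAm t)
  rw [← hG, ← lintegral_add_left' (Finset.aemeasurable_fun_sum _ fun t _ => hind t)]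
  -- For each ghost `x'`, the count on `x` is the count on `x'` plus their difference, and `supSum`
  -- with weights `1` and `-1` dominates the difference.
  calc ENNReal.ofReal (∑ t, if h (x t) ≠ g (x t) then 1 else 0)
      = ∫⁻ _x' : ι → X, ENNReal.ofReal (∑ t, if h (x t) ≠ g (x t) then 1 else 0)
          ∂(Measure.pi ν) := by simp
    _ ≤ _ := by
        refine lintegral_mono fun x' => ?_
        have h1 : ∑ t, ((fun x : ι → X => x t) ⁻¹' A).indicator (1 : (ι → X) → ℝ≥0∞) x' =
            ENNReal.ofReal (∑ t, if h (x' t) ≠ g (x' t) then 1 else 0) := by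
          rw [ENNReal.ofReal_sum_of_nonneg fun t _ => by split_ifs <;> norm_num]
          refine Finset.sum_congr rfl fun t _ => ?_
          by_cases hx : h (x' t) = g (x' t) <;> simp [hA, hx, Set.indicator]
        have h2 : ENNReal.ofReal ((∑ t, if h (x t) ≠ g (x t) then 1 else 0) +
            ∑ t, if h (x' t) ≠ g (x' t) then -1 else 0) ≤
            supSum H (Sum.elim (fun _ => 1) fun _ => -1) (Sum.elim x x') := by
          have := le_supSum hh hg (Sum.elim (fun _ : ι => (1 : ℝ)) fun _ => -1) (Sum.elim x x')
          rw [Fintype.sum_sum_type] at this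
          exact this
        rw [h1]
        refine le_trans ?_ (add_le_add_right h2 _)
        rw [add_comm]
        refine le_trans (ENNReal.ofReal_le_ofReal (le_of_eq ?_)) ENNReal.ofReal_add_le
        rw [add_assoc, ← Finset.sum_add_distrib]
        have : ∀ t, (if h (x' t) ≠ g (x' t) then (-1 : ℝ) else 0) +
            (if h (x' t) ≠ g (x' t) then 1 else 0) = 0 := fun t => by split_ifs <;> norm_num
        simp only [this, Finset.sum_const_zero, add_zero]

end Symmetrization

/-- The expected uniform deviation between two independent samples is bounded in
terms of the complexity. -/
theorem lintegral_ghost_le [MeasurableSpace X] {μ : ProbabilityMeasure X} {H : Set (X → Y)}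
    (hH : H.Nonempty) (hmeas : MeasurableDisagreement H μ) {n : ℕ} (hn : 1 ≤ n) {ε σ : ℝ}
    (hε : 0 ≤ ε) {ν : Fin n → ProbabilityMeasure X} (hν : ∀ i, ν i ∈ smooth μ σ) {c l : ℝ}
    (hl : 0 < l) (hc : 1 ≤ c) (hC : complexity ε σ H μ ≤ ENNReal.ofReal c) :
    ∫⁻ x, ∫⁻ x', supSum H (Sum.elim (fun _ => 1) fun _ => -1) (Sum.elim x x')
        ∂(Measure.pi fun i => (ν i : Measure X)) ∂(Measure.pi fun i => (ν i : Measure X)) ≤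
      2 * ENNReal.ofReal (2 / l * Real.log c + 2 * ε * n + l * n / 2) := by
  have hac : ∀ i, (ν i : Measure X) ≪ μ := fun i => smooth_absolutelyContinuous (hν i)
  set P := Measure.pi fun i => (ν i : Measure X)
  set I := ∫⁻ x, ∫⁻ x', supSum H (Sum.elim (fun _ => 1) fun _ => -1) (Sum.elim x x') ∂P ∂P
  set K := ENNReal.ofReal (2 / l * Real.log c + 2 * ε * n + l * n / 2)
  have hc0 : 0 < c := by linarith
  have h2n : (2 : ℝ≥0∞) ^ n ≠ 0 := by simp
  have h2n' : (2 : ℝ≥0∞) ^ n ≠ ⊤ := by simp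
  have h1 : (2 : ℝ≥0∞) ^ n * I ≤ 2 * ∑ b : Fin n → Bool, ∫⁻ x, supSum H (fun t => sgn (b t)) x ∂P := by
    -- Flipping all signs permutes the sign vectors, so both halves contribute equally; hence the
    -- factor `2`.
    have hflip : ∑ b : Fin n → Bool, ∫⁻ x, supSum H (fun t => sgn (!b t)) x ∂P =
        ∑ b : Fin n → Bool, ∫⁻ x, supSum H (fun t => sgn (b t)) x ∂P :=
      Equiv.sum_comp (Equiv.piCongrRight fun _ : Fin n => Equiv.boolNot)
        fun b => ∫⁻ x, supSum H (fun t => sgn (b t)) x ∂P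
    calc (2 : ℝ≥0∞) ^ n * I = ∑ _b : Fin n → Bool, I := by simp
      _ ≤ ∑ b : Fin n → Bool, (∫⁻ x, supSum H (fun t => sgn (b t)) x ∂P +
            ∫⁻ x, supSum H (fun t => sgn (!b t)) x ∂P) :=
          Finset.sum_le_sum fun b _ => lintegral_lintegral_supSum_le hmeas hac b
      _ = _ := by rw [Finset.sum_add_distrib, hflip, two_mul]
  have h3 : ∑ b : Fin n → Bool, ∫⁻ x, supSum H (fun t => sgn (b t)) x ∂P ≤ 2 ^ n * K := by
    rw [← lintegral_finsetSum' _ fun b _ => aemeasurable_supSum hmeas _ hac]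
    have h4 := lintegral_mono (μ := P) fun x => sum_supSum_add_le hH hn x hε hl hc
    rw [lintegral_add_right _ measurable_const, lintegral_const, measure_univ, mul_one,
      lintegral_const_mul' _ _ h2n', lintegral_add_left measurable_const, lintegral_const,
      measure_univ, mul_one, lintegral_const_mul' _ _ ENNReal.ofReal_ne_top, mul_add] at h4
    -- The expected covering number is at most `c`, so this term is at most the `2/l` added on the
    -- left, and the two cancel.
    have h5 : ENNReal.ofReal (2 / (l * c)) * ∫⁻ x : Fin n → X,
        ((coveringNumber (empDist x) ε H : ℕ∞) : ℝ≥0∞) ∂P ≤ ENNReal.ofReal (2 / l) := by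
      calc _ ≤ ENNReal.ofReal (2 / (l * c)) * ENNReal.ofReal c := by
            gcongr
            exact (lintegral_coveringNumber_le_complexity hn hν).trans hC
        _ = _ := by
            rw [← ENNReal.ofReal_mul (by positivity)]
            congr 1; field_simp
    refine (ENNReal.add_le_add_iff_right (a := 2 ^ n * ENNReal.ofReal (2 / l))
      (ENNReal.mul_ne_top h2n' ENNReal.ofReal_ne_top)).1 (h4.trans ?_)
    gcongr
  have h6 : (2 : ℝ≥0∞) ^ n * I ≤ 2 ^ n * (2 * K) := by
    calc _ ≤ _ := h1
      _ ≤ 2 * (2 ^ n * K) := by gcongr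
      _ = _ := by ring
  exact (ENNReal.mul_le_mul_iff_right h2n h2n').1 h6

/-! ### Regret bounds -/

theorem nonempty_of_class [MeasurableSpace X] (μ : ProbabilityMeasure X) {H : Set (X → Y)}
    (hH : H.Nonempty) : Nonempty Y := by
  have := nonempty_of_isProbabilityMeasure (μ : Measure X)
  exact ⟨hH.some (Classical.arbitrary X)⟩

theorem minimaxRegret_le_natCast [MeasurableSpace X] (μ : ProbabilityMeasure X) (σ : ℝ) (T : ℕ)
    {H : Set (X → Y)} (hH : H.Nonempty) : minimaxRegret μ σ T H ≤ T := by
  have hY := nonempty_of_class μ hH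
  refine (iInf_le _ fun _ _ _ => PMF.pure (Classical.arbitrary Y)).trans (iSup₂_le fun ν _ => ?_)
  refine (upperExpectation_le_lintegral (g := fun _ => (T : ℝ≥0∞)) aemeasurable_const
    fun x => ?_).trans (by simp)
  rw [← ENNReal.ofReal_natCast]
  refine ENNReal.ofReal_le_ofReal (worstRegret_le hH fun y g _ => ?_)
  linarith [sum_expectedLoss_le (fun _ _ _ => PMF.pure (Classical.arbitrary Y)) x y,
    mistakes_nonneg g x y]

theorem minimaxRegret_eq_zero_of_one_lt [MeasurableSpace X] {μ : ProbabilityMeasure X} {σ : ℝ}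
    (hσ : 1 < σ) (T : ℕ) {H : Set (X → Y)} (hH : H.Nonempty) : minimaxRegret μ σ T H = 0 := by
  -- For `T = 0` the empty sequence of measures is vacuously smooth, so the supremum is not over an
  -- empty set.
  rcases Nat.eq_zero_or_pos T with rfl | hT
  · simpa using minimaxRegret_le_natCast μ σ 0 hH
  · have hY := nonempty_of_class μ hH
    refine le_antisymm ?_ zero_le
    refine (iInf_le _ fun _ _ _ => PMF.pure (Classical.arbitrary Y)).trans (iSup₂_le fun ν hν => ?_)
    have := hν ⟨0, hT⟩
    rw [smooth_eq_empty μ hσ] at this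
    exact this.elim

theorem one_le_complexity [MeasurableSpace X] {μ : ProbabilityMeasure X} {H : Set (X → Y)}
    (hH : H.Nonempty) (hmeas : MeasurableDisagreement H μ) (ε : ℝ) {σ : ℝ} (hσ : σ ≤ 1) :
    1 ≤ complexity ε σ H μ := by
  obtain ⟨h, hh⟩ := hH
  have := card_le_complexity hmeas.pair (ε := ε) hσ (s := {h}) (by simpa using hh)
    fun a ha b hb hab => absurd ((Finset.mem_singleton.1 ha).trans (Finset.mem_singleton.1 hb).symm) hab
  simpa using this

/-- Exponential weights over a finite cover of the class: regret on a fixed sample. -/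
theorem worstRegret_hedge_le [MeasurableSpace X] {μ : ProbabilityMeasure X} {H : Set (X → Y)}
    (hH : H.Nonempty) (hmeas : MeasurableDisagreement H μ) {T : ℕ} {ε σ : ℝ} (hε : 0 ≤ ε)
    (hσ : 0 < σ) {ν : Fin T → ProbabilityMeasure X} (hν : ∀ i, ν i ∈ smooth μ σ)
    {s : Finset (X → Y)} (hs : s.Nonempty) (hsH : (s : Set (X → Y)) ⊆ H)
    (hcov : ∀ h ∈ H, ∃ g ∈ s, (μ : Measure X).real {x | h x ≠ g x} ≤ 2 * ε)
    {l : ℝ} (hl : 0 < l) (x : Fin T → X) :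
    ENNReal.ofReal (worstRegret (hedge s hs l) H x) ≤
      ENNReal.ofReal (Real.log s.card / l + l * T / 2) + ENNReal.ofReal (2 * ε * T / σ) +
        ∫⁻ x', supSum H (Sum.elim (fun _ => 1) fun _ => -1) (Sum.elim x x')
          ∂(Measure.pi fun i => (ν i : Measure X)) := by
  classical
  have hY := nonempty_of_class μ hH
  set I := ∫⁻ x', supSum H (Sum.elim (fun _ => 1) fun _ => -1) (Sum.elim x x')
    ∂(Measure.pi fun i => (ν i : Measure X)) with hI
  rcases eq_or_ne I ⊤ with hItop | hItop
  · rw [hItop, add_top]; exact le_top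
  have hlog : 0 ≤ Real.log s.card := Real.log_natCast_nonneg _
  rw [← ENNReal.ofReal_toReal hItop, ← ENNReal.ofReal_add (by positivity) (by positivity),
    ← ENNReal.ofReal_add (by positivity) (by positivity)]
  refine ENNReal.ofReal_le_ofReal (worstRegret_le hH fun y h hh => ?_)
  obtain ⟨g, hg, hd⟩ := hcov h hh
  have h1 := hedge_sum_loss_le hs hl x y hg
  have h2 := mistakes_le_add h g x y
  have h3 : ∑ t, (if h (x t) ≠ g (x t) then (1 : ℝ) else 0) ≤ 2 * ε * T / σ + I.toReal := by
    rw [← ENNReal.ofReal_le_ofReal_iff (by positivity), ENNReal.ofReal_add (by positivity)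
      (by positivity), ENNReal.ofReal_toReal hItop]
    refine (disagreement_le_ghost hmeas (fun i => smooth_absolutelyContinuous (hν i)) hh (hsH hg)
      x).trans (add_le_add_left ?_ _)
    -- Smoothness transfers the cover's guarantee from `μ` to each `ν t` at the price of `1/σ`.
    calc ∑ t, (ν t : Measure X) {z | h z ≠ g z} ≤ ∑ _t : Fin T, ENNReal.ofReal (2 * ε / σ) := by
          refine Finset.sum_le_sum fun t _ => (smooth_apply_le (hν t) _).trans ?_
          rw [ENNReal.ofReal_div_of_pos hσ]
          gcongr
          rw [← ofReal_measureReal]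
          exact ENNReal.ofReal_le_ofReal hd
      _ = ENNReal.ofReal (2 * ε * T / σ) := by
          rw [← ENNReal.ofReal_sum_of_nonneg fun _ _ => by positivity]
          congr 1
          simp
          ring
  linarith

/-- With `L = log C`, exponential weights cost `L/l + lT/2`, the ghost sample `2εT/σ`, and the
deviation `2(2L/l + 2εT + lT/2)`; `σ ≤ 1` absorbs `4εT` into `4εT/σ`. -/
theorem minimaxRegret_le_of_rate [MeasurableSpace X] {μ : ProbabilityMeasure X} {H : Set (X → Y)}
    (hH : H.Nonempty) (hmeas : MeasurableDisagreement H μ) {T : ℕ} (hT : 1 ≤ T) {ε σ : ℝ}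
    (hε : 0 < ε) (hσ : 0 < σ) (hσ1 : σ ≤ 1) (hC : complexity ε σ H μ ≠ ∞) {l : ℝ} (hl : 0 < l) :
    minimaxRegret μ σ T H ≤ ENNReal.ofReal
      (6 * ε * T / σ + 5 * Real.log (complexity ε σ H μ).toReal / l + 3 / 2 * l * T) := by
  set c := (complexity ε σ H μ).toReal with hc
  have hc1 : 1 ≤ c := by
    rw [hc, ← ENNReal.toReal_one]
    exact ENNReal.toReal_mono hC (one_le_complexity hH hmeas ε hσ1)
  have hCc : complexity ε σ H μ ≤ ENNReal.ofReal c := (ENNReal.ofReal_toReal hC).ge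
  obtain ⟨s, hsH, hcard, hcov⟩ := exists_finset_cover hmeas.pair hε hσ1 hC
  have hs : s.Nonempty := by
    obtain ⟨h, hh⟩ := hH
    obtain ⟨g, hg, -⟩ := hcov h hh
    exact ⟨g, hg⟩
  have hcard' : (s.card : ℝ) ≤ c := by
    rw [← ENNReal.toReal_natCast]
    exact ENNReal.toReal_mono hC hcard
  have hlog : Real.log s.card ≤ Real.log c :=
    Real.log_le_log (by exact_mod_cast hs.card_pos) hcard'
  have hlogs : 0 ≤ Real.log s.card := Real.log_natCast_nonneg _
  have hlogc : 0 ≤ Real.log c := Real.log_nonneg hc1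
  -- The cover `s` is chosen before `ν`, so one learner serves every smooth adversary.
  refine (iInf_le _ (hedge s hs l)).trans (iSup₂_le fun ν hν => ?_)
  have hac : ∀ i, (ν i : Measure X) ≪ μ := fun i => smooth_absolutelyContinuous (hν i)
  refine (upperExpectation_le_lintegral (aemeasurable_const.add
    (aemeasurable_supSum_sumElim hmeas hac _).lintegral_prod_right')
    (worstRegret_hedge_le hH hmeas hε.le hσ hν hs hsH hcov hl)).trans ?_
  simp only [Pi.add_apply]
  rw [lintegral_add_left measurable_const, lintegral_const, measure_univ, mul_one]
  refine (add_le_add_right (lintegral_ghost_le hH hmeas hT hε.le hν hl hc1 hCc) _).trans ?_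
  rw [← ENNReal.ofReal_add (by positivity) (by positivity), ← ENNReal.ofReal_ofNat (n := 2),
    ← ENNReal.ofReal_mul (by norm_num), ← ENNReal.ofReal_add (by positivity) (by positivity)]
  refine ENNReal.ofReal_le_ofReal ?_
  have h1 : Real.log s.card / l ≤ Real.log c / l := by gcongr
  have h2 : ε * T ≤ ε * T / σ := le_div_self (by positivity) hσ hσ1
  have e1 : 2 * ε * T / σ = 2 * (ε * T / σ) := by ring
  have e2 : 6 * ε * T / σ = 6 * (ε * T / σ) := by ring
  have e3 : 5 * Real.log c / l = 5 * (Real.log c / l) := by ring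
  have e4 : 2 / l * Real.log c = 2 * (Real.log c / l) := by ring
  rw [e1, e2, e3, e4]
  linarith

theorem minimaxRegret_le_sqrt [MeasurableSpace X] {μ : ProbabilityMeasure X} {H : Set (X → Y)}
    (hH : H.Nonempty) (hmeas : MeasurableDisagreement H μ) {T : ℕ} (hT : 1 ≤ T) {ε σ : ℝ}
    (hε : 0 < ε) (hσ : 0 < σ) (hσ1 : σ ≤ 1) (hC : complexity ε σ H μ ≠ ∞) :
    minimaxRegret μ σ T H ≤ ENNReal.ofReal
      (6 * ε * T / σ + 6 * √(T * Real.log (complexity ε σ H μ).toReal)) := by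
  set L := Real.log (complexity ε σ H μ).toReal with hL
  have hT' : (0 : ℝ) < T := by exact_mod_cast hT
  have hrate : ∀ {l : ℝ}, 0 < l → minimaxRegret μ σ T H ≤
      ENNReal.ofReal (6 * ε * T / σ + 5 * L / l + 3 / 2 * l * T) := fun hl =>
    minimaxRegret_le_of_rate hH hmeas hT hε hσ hσ1 hC hl
  have hL0 : 0 ≤ L := by
    refine Real.log_nonneg ?_
    rw [← ENNReal.toReal_one]
    exact ENNReal.toReal_mono hC (one_le_complexity hH hmeas ε hσ1)
  rcases hL0.eq_or_lt with h0 | h0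
  -- If `L = 0` there is no optimal rate; `l` is sent to `0`.
  · refine ENNReal.le_of_forall_pos_le_add fun δ hδ _ => ?_
    have hδ' : (0 : ℝ) < δ := hδ
    refine (hrate (l := δ / (3 / 2 * T)) (by positivity)).trans ?_
    rw [← h0, ← ENNReal.ofReal_coe_nnreal, ← ENNReal.ofReal_add (by positivity) (by positivity)]
    refine ENNReal.ofReal_le_ofReal (le_of_eq ?_)
    have : 3 / 2 * ((δ : ℝ) / (3 / 2 * T)) * T = δ := by field_simp
    rw [this]
    simp
  · have hq : 0 < √(T * L) := Real.sqrt_pos.2 (by positivity)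
    have hqq : √(T * L) * √(T * L) = T * L := Real.mul_self_sqrt (by positivity)
    -- This rate nearly balances the two terms, giving the factor `5/2 + 3 ≤ 6`.
    refine (hrate (l := 2 * √(T * L) / T) (by positivity)).trans (ENNReal.ofReal_le_ofReal ?_)
    have e1 : 5 * L / (2 * √(T * L) / T) = 5 / 2 * √(T * L) := by
      generalize √(T * L) = q at hq hqq
      rw [div_eq_iff (by positivity)]
      field_simp
      linarith
    have e2 : 3 / 2 * (2 * √(T * L) / T) * T = 3 * √(T * L) := by field_simp
    rw [e1, e2]
    linarith

/-- For `ε ≤ 1` the previous bound is used at scale `ε²`, with `ε² ≤ ε`. For `ε > 1` the trivial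
bound `T` suffices. -/
theorem minimaxRegret_le [MeasurableSpace X] {μ : ProbabilityMeasure X} {H : Set (X → Y)}
    (hH : H.Nonempty) (hmeas : MeasurableDisagreement H μ) (T : ℕ) {ε σ : ℝ}
    (hε : 0 < ε) (hσ : 0 < σ) :
    minimaxRegret μ σ T H ≤ 6 * (ENNReal.ofReal (ε * T / σ) +
      ((T : ℝ≥0∞) * (ENNReal.log (complexity (ε ^ 2) σ H μ)).toENNReal) ^ (1 / 2 : ℝ)) := by
  rcases lt_or_ge 1 σ with hσ1 | hσ1
  · rw [minimaxRegret_eq_zero_of_one_lt hσ1 T hH]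
    exact zero_le
  rcases Nat.eq_zero_or_pos T with rfl | hT
  · refine (minimaxRegret_le_natCast μ σ 0 hH).trans ?_
    simp
  have hT' : (0 : ℝ) < T := by exact_mod_cast hT
  have h6 : (6 : ℝ≥0∞) = ENNReal.ofReal 6 := by simp
  rcases lt_or_ge 1 ε with hε1 | hε1
  · refine (minimaxRegret_le_natCast μ σ T hH).trans ?_
    rw [mul_add, h6, ← ENNReal.ofReal_mul (by norm_num)]
    refine le_trans ?_ le_self_add
    rw [← ENNReal.ofReal_natCast]
    refine ENNReal.ofReal_le_ofReal ?_
    have h1 : (T : ℝ) ≤ ε * T := by nlinarith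
    have h2 : ε * T ≤ ε * T / σ := le_div_self (by positivity) hσ hσ1
    linarith
  rcases eq_or_ne (complexity (ε ^ 2) σ H μ) ⊤ with hC | hC
  · rw [hC]
    have hTne : (T : ℝ≥0∞) ≠ 0 := by exact_mod_cast hT.ne'
    have : 6 * (ENNReal.ofReal (ε * T / σ) +
        ((T : ℝ≥0∞) * (ENNReal.log ⊤).toENNReal) ^ (1 / 2 : ℝ)) = ⊤ := by
      rw [ENNReal.log_top, EReal.toENNReal_top, ENNReal.mul_top hTne,
        ENNReal.top_rpow_of_pos (by norm_num), add_top, ENNReal.mul_top (by norm_num)]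
    rw [this]
    exact le_top
  · refine (minimaxRegret_le_sqrt hH hmeas hT (by positivity) hσ hσ1 hC).trans ?_
    have h1 := one_le_complexity hH hmeas (ε ^ 2) hσ1
    set c := (complexity (ε ^ 2) σ H μ).toReal with hc
    have hc1 : 1 ≤ c := by
      rw [hc, ← ENNReal.toReal_one]
      exact ENNReal.toReal_mono hC h1
    have hlog : (ENNReal.log (complexity (ε ^ 2) σ H μ)).toENNReal = ENNReal.ofReal (Real.log c) := by
      rw [← ENNReal.ofReal_toReal hC, ENNReal.log_ofReal_of_pos (by linarith)]
      exact EReal.toENNReal_of_ne_top (EReal.coe_ne_top _)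
    have hlogc : 0 ≤ Real.log c := Real.log_nonneg hc1
    rw [hlog, ← ENNReal.ofReal_natCast, ← ENNReal.ofReal_mul hT'.le,
      ENNReal.ofReal_rpow_of_nonneg (by positivity) (by norm_num), ← Real.sqrt_eq_rpow,
      ← ENNReal.ofReal_add (by positivity) (by positivity), h6, ← ENNReal.ofReal_mul (by norm_num)]
    refine ENNReal.ofReal_le_ofReal ?_
    have h2 : 6 * ε ^ 2 * T / σ ≤ 6 * (ε * T / σ) := by
      rw [← mul_div_assoc, ← mul_assoc]
      gcongr
      nlinarith
    linarith

theorem learnableUnder_of_UBEME [MeasurableSpace X] {μ : ProbabilityMeasure X} {H : Set (X → Y)}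
    (hH : H.Nonempty) (hmeas : MeasurableDisagreement H μ) (hU : UBEME H μ) :
    LearnableUnder H μ := by
  intro σ hσ
  rw [ENNReal.tendsto_nhds_zero]
  intro δ hδ
  obtain ⟨r, hr0, hrδ⟩ := ENNReal.lt_iff_exists_nnreal_btwn.1 hδ
  have hr : (0 : ℝ) < r := by exact_mod_cast hr0
  -- Makes the linear term `6εT/σ` equal to `rT/2`; the square root term, divided by `T`, tends to
  -- `0`.
  set ε : ℝ := r * σ / 12
  have hε : 0 < ε := by positivity
  set M := (ENNReal.log (complexity (ε ^ 2) σ H μ)).toENNReal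
  have hM : M ≠ ⊤ := by
    rw [Ne, EReal.toENNReal_eq_top_iff, ENNReal.log_eq_top_iff]
    exact (hU _ _ (by positivity) hσ).ne
  have hlim : Tendsto (fun T : ℕ => 6 * √(M.toReal / T)) atTop (𝓝 0) := by
    have h1 : Tendsto (fun T : ℕ => M.toReal / T) atTop (𝓝 0) :=
      tendsto_const_div_atTop_nhds_zero_nat _
    simpa using (Real.continuous_sqrt.tendsto 0 |>.comp h1).const_mul 6
  filter_upwards [hlim.eventually_le_const (half_pos hr), eventually_ge_atTop 1] with T hT hT1
  have hT' : (0 : ℝ) < T := by exact_mod_cast hT1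
  refine le_trans ?_ hrδ.le
  rw [ENNReal.div_le_iff (by exact_mod_cast hT'.ne') (by simp)]
  refine (minimaxRegret_le hH hmeas T hε hσ).trans ?_
  have h6 : (6 : ℝ≥0∞) = ENNReal.ofReal 6 := by simp
  change 6 * (_ + ((T : ℝ≥0∞) * M) ^ (1 / 2 : ℝ)) ≤ _
  rw [← ENNReal.ofReal_toReal hM, ← ENNReal.ofReal_natCast, ← ENNReal.ofReal_mul hT'.le,
      ENNReal.ofReal_rpow_of_nonneg (by positivity) (by norm_num), ← Real.sqrt_eq_rpow,
      ← ENNReal.ofReal_add (by positivity) (by positivity), h6, ← ENNReal.ofReal_mul (by norm_num),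
      ← ENNReal.ofReal_coe_nnreal, ← ENNReal.ofReal_mul (by positivity)]
  refine ENNReal.ofReal_le_ofReal ?_
  have e1 : 6 * (ε * T / σ) = r / 2 * T := by simp only [ε]; field_simp; norm_num
  have e2 : √(T * M.toReal) = √(M.toReal / T) * T := by
    rw [show T * M.toReal = M.toReal / T * T ^ 2 by field_simp, Real.sqrt_mul (by positivity),
      Real.sqrt_sq hT'.le]
  rw [mul_add, e1, e2]
  nlinarith

end SmoothedOnline

end

theorem theorem4p1 {X Y : Type*} [MeasurableSpace X] (H : Set (X → Y)) (hH : H.Nonempty)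
    (μ : ProbabilityMeasure X) (hmeas : SmoothedOnline.MeasurableDisagreement H μ) :
    (∀ σ : ℝ, 0 < σ → ∀ T : ℕ,
      SmoothedOnline.minimaxRegret μ σ T H ≤
        6 * ⨅ (ε : ℝ) (_ : 0 < ε),
          (ENNReal.ofReal (ε * T / σ) +
            ((T : ℝ≥0∞) *
              (ENNReal.log (SmoothedOnline.complexity (ε ^ 2) σ H μ)).toENNReal) ^ (1 / 2 : ℝ))) ∧
    (SmoothedOnline.UBEME H μ → SmoothedOnline.LearnableUnder H μ) := by
  refine ⟨fun σ hσ T => ?_, SmoothedOnline.learnableUnder_of_UBEME hH hmeas⟩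
  -- Dividing by `6` frees the infimum, so that each `ε` can be treated separately.
  rw [mul_comm, ← ENNReal.div_le_iff (by norm_num) (by norm_num)]
  refine le_iInf₂ fun ε hε => ?_
  rw [ENNReal.div_le_iff (by norm_num) (by norm_num), mul_comm]
  exact SmoothedOnline.minimaxRegret_le hH hmeas T hε hσ
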